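/- A \emph{$C^*$-category} is a $\mathbb{C}$-linear category whose hom spaces carry a conjugate-linear involution $\dagger:\mathcal{C}(a\to b)\to\mathcal{C}(b\to a)$ with $(f\circ g)^\dagger=g^\dagger\circ f^\dagger$ and complete submultiplicative norms with $\|f\|^2=\|f^\dagger f\|=\|ff^\dagger\|$, such that each $f^\dagger f$ is of the form $g^\dagger g$ for an endomorphism $g$. A \emph{unitary tensor category} is a $C^*$-category with finite orthogonal direct sums and split orthogonal projections, equipped with a bilinear monoidal structure with $(f\otimes g)^\dagger=f^\dagger\otimes g^\dagger$ and unitary associators and unitors, which is rigid and semisimple (every object is a finite direct sum of simple objects and the hom spaces are finite-dimensional) and satisfies $\dim\operatorname{End}(1)=1$. Let $\mathcal{C}$ be a unitary tensor category equipped with a braiding $\sigma$ (the braiding is not required to be unitary). An object $a\in\mathcal{C}$ \emph{centralizes} a full subcategory $\mathcal{D}\subseteq\mathcal{C}$ if $\sigma_{d,a}\circ\sigma_{a,d}=\operatorname{id}_{a\otimes d}$ for every $d\in\mathcal{D}$. A \emph{fusion subcategory} of $\mathcal{C}$ is a full, replete subcategory containing the tensor unit, closed under tensor products, duals, finite direct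 sums and direct summands, and having only finitely many isomorphism classes of simple objects. It is \emph{non-degenerately braided} if every simple object of $\mathcal{D}$ that centralizes $\mathcal{D}$ is isomorphic to the tensor unit. \textbf{Proposition.} Let $\mathcal{C}$ be a braided unitary tensor category and let $\mathcal{D}\subsetneq\mathcal{C}$ be a proper fusion subcategory that is non-degenerately braided. Then there exists a simple object $a$ of $\mathcal{C}$ that does not belong to $\mathcal{D}$ and that centralizes $\mathcal{D}$. -/

import Mathlib

open CategoryTheory MonoidalCategory

universe v u

namespace UnitaryCat

/-- A dagger category: an involutive, identity-on-objects contravariant operation on morphisms. -/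
class DaggerCategory (C : Type u) [Category.{v} C] where
  /-- The adjoint of a morphism. -/
  dag : ∀ {X Y : C}, (X ⟶ Y) → (Y ⟶ X)
  dag_dag : ∀ {X Y : C} (f : X ⟶ Y), dag (dag f) = f
  dag_comp : ∀ {X Y Z : C} (f : X ⟶ Y) (g : Y ⟶ Z), dag (f ≫ g) = dag g ≫ dag f

open DaggerCategory (dag)

/-- A `C*`-category: a `ℂ`-linear dagger category with conjugate-linear dagger and a complete
submultiplicative norm on every hom space that satisfies the `C*`-identities, and in which every
`f† ∘ f` is a positive endomorphism. Recall that `f ≫ dag f` is `f† ∘ f`. -/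
class CStarCategory (C : Type u) [Category.{v} C] [Preadditive C] [Linear ℂ C]
    extends DaggerCategory C where
  dag_add : ∀ {X Y : C} (f g : X ⟶ Y), dag (f + g) = dag f + dag g
  dag_smul : ∀ {X Y : C} (z : ℂ) (f : X ⟶ Y), dag (z • f) = (starRingEnd ℂ) z • dag f
  /-- The norm on the hom spaces. -/
  homNorm : ∀ X Y : C, Norm (X ⟶ Y)
  normedSpaceCore : ∀ X Y : C, NormedSpace.Core ℂ (X ⟶ Y)
  complete : ∀ X Y : C,
    letI : NormedAddCommGroup (X ⟶ Y) := NormedAddCommGroup.ofCore (normedSpaceCore X Y)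
    CompleteSpace (X ⟶ Y)
  norm_comp_le : ∀ {X Y Z : C} (f : X ⟶ Y) (g : Y ⟶ Z), ‖f ≫ g‖ ≤ ‖f‖ * ‖g‖
  norm_comp_dag : ∀ {X Y : C} (f : X ⟶ Y), ‖f ≫ dag f‖ = ‖f‖ ^ 2
  norm_dag_comp : ∀ {X Y : C} (f : X ⟶ Y), ‖dag f ≫ f‖ = ‖f‖ ^ 2
  positive : ∀ {X Y : C} (f : X ⟶ Y), ∃ g : X ⟶ X, f ≫ dag f = g ≫ dag g

/-- A `C*`-tensor category: a `C*`-category with a bilinear monoidal structure that is compatible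
with the dagger, so that the tensor product is a dagger functor and the associators and unitors
are unitary. -/
class CStarTensorCategory (C : Type u) [Category.{v} C] [Preadditive C] [Linear ℂ C]
    [MonoidalCategory C] [MonoidalPreadditive C] [MonoidalLinear ℂ C]
    extends CStarCategory C where
  dag_tensorHom : ∀ {X Y X' Y' : C} (f : X ⟶ Y) (g : X' ⟶ Y'), dag (f ⊗ₘ g) = dag f ⊗ₘ dag g
  dag_associator : ∀ X Y Z : C, dag (α_ X Y Z).hom = (α_ X Y Z).inv
  dag_leftUnitor : ∀ X : C, dag (λ_ X).hom = (λ_ X).inv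
  dag_rightUnitor : ∀ X : C, dag (ρ_ X).hom = (ρ_ X).inv

/-- The morphisms `s i : S i ⟶ X` exhibit `X` as the orthogonal direct sum of the `S i`: they are
isometries with mutually orthogonal ranges that add up to the identity of `X`. -/
structure IsOrthogonalSum {C : Type u} [Category.{v} C] [Preadditive C] [DaggerCategory C]
    {n : ℕ} (S : Fin n → C) (X : C) (s : ∀ i, S i ⟶ X) : Prop where
  isometry : ∀ i, s i ≫ dag (s i) = 𝟙 (S i)
  orthogonal : ∀ i j, i ≠ j → s i ≫ dag (s j) = 0
  sum_eq : ∑ i, dag (s i) ≫ s i = 𝟙 X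

/-- A unitary tensor category: a rigid `C*`-tensor category that has finite orthogonal direct sums
(the empty one included) and in which orthogonal projections split, that is semisimple (with
finite-dimensional hom spaces), and whose tensor unit has one-dimensional endomorphism space. -/
class UnitaryTensorCategory (C : Type u) [Category.{v} C] [Preadditive C] [Linear ℂ C]
    [MonoidalCategory C] [MonoidalPreadditive C] [MonoidalLinear ℂ C] [RigidCategory C]
    extends CStarTensorCategory C where
  exists_sum : ∀ {n : ℕ} (S : Fin n → C), ∃ (X : C) (s : ∀ i, S i ⟶ X), IsOrthogonalSum S X s
  projection_split : ∀ {X : C} (p : X ⟶ X), p ≫ p = p → dag p = p →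
    ∃ (Y : C) (w : Y ⟶ X), w ≫ dag w = 𝟙 Y ∧ dag w ≫ w = p
  finiteDimensional_hom : ∀ X Y : C, FiniteDimensional ℂ (X ⟶ Y)
  semisimple : ∀ X : C, ∃ (n : ℕ) (S : Fin n → C) (s : ∀ i, S i ⟶ X),
    (∀ i, Simple (S i)) ∧ IsOrthogonalSum S X s
  finrank_unit : Module.finrank ℂ (𝟙_ C ⟶ 𝟙_ C) = 1

/-- Two objects of a braided category centralize each other if their double braiding is trivial. -/
def Centralizes {C : Type u} [Category.{v} C] [MonoidalCategory C] [BraidedCategory C]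
    (X Y : C) : Prop :=
  (β_ X Y).hom ≫ (β_ Y X).hom = 𝟙 (X ⊗ Y)

/-- The object `X` centralizes every object of the full subcategory `D`. -/
def CentralizesSubcategory {C : Type u} [Category.{v} C] [MonoidalCategory C] [BraidedCategory C]
    (X : C) (D : ObjectProperty C) : Prop :=
  ∀ Y : C, D Y → Centralizes X Y

/-- A (full, replete) fusion subcategory of a unitary tensor category: it contains the unit, is
closed under tensor products, duals, finite direct sums and direct summands (so also under
isomorphisms), and has only finitely many simple objects up to isomorphism. -/
class IsFusionSubcategory {C : Type u} [Category.{v} C] [Preadditive C] [Linear ℂ C]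
    [MonoidalCategory C] [MonoidalPreadditive C] [MonoidalLinear ℂ C] [RigidCategory C]
    [UnitaryTensorCategory C] (D : ObjectProperty C) : Prop
    extends D.IsMonoidal, D.IsStableUnderRetracts where
  rightDual_mem : ∀ X : C, D X → D (HasRightDual.rightDual X)
  leftDual_mem : ∀ X : C, D X → D (HasLeftDual.leftDual X)
  sum_mem : ∀ {n : ℕ} (S : Fin n → C) (X : C) (s : ∀ i, S i ⟶ X),
    IsOrthogonalSum S X s → (∀ i, D (S i)) → D X
  finite_simple : ∃ (n : ℕ) (S : Fin n → C),
    ∀ X : C, D X → Simple X → ∃ i, Nonempty (X ≅ S i)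

/-- The braiding restricted to the full subcategory `D` is non-degenerate: up to isomorphism the
tensor unit is the only simple object of `D` that centralizes `D`. -/
def IsNondegenerate {C : Type u} [Category.{v} C] [Preadditive C] [MonoidalCategory C]
    [BraidedCategory C] (D : ObjectProperty C) : Prop :=
  ∀ X : C, D X → Simple X → CentralizesSubcategory X D → Nonempty (X ≅ 𝟙_ C)

end UnitaryCat

/-! The proof uses circles coloured by all of `D`. For an object `X`, `kirby` is the endomorphism
given by a circle around `X` labelled by the simple objects of `D`, weighted by their dimensions. A
strand from `D` slides over this circle (`kirby_handle_slide`). If the circle acts on a simple `X`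
by a nonzero scalar, the scalar cancels from the sliding identity and the double braiding of `X`
with `D` is trivial. By non-degeneracy the circle therefore vanishes on the nontrivial simple
objects of `D`; the argument also works with all crossings reversed.

Now let `X` be simple and outside `D`. In the circle around `X ⊗ S j`, close the strand `S j`,
weight by its dimension `d j` and sum over `j`. The closed strand can be pulled off `X`
(`rightPartialTrace_encircle`) and becomes a reversed weighted circle around the dual strand of the
first circle. That kills every label except the unit, and what remains is a positive multiple of the
identity of `X`. So the circle is nonzero on some `X ⊗ S j`, hence on a simple summand `A` of it,
and `A` centralizes `D`. If `A` were in `D`, then so would be `X`, a summand of `A ⊗ S' j`.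

Neither a pivotal structure nor unitarity of the braiding is available, so circles are closed with a
coevaluation and its dagger. Once pairings are rescaled so that left and right traces agree,
positivity forces these traces to be tracial (`rightTrace_comp_comm`); the comparison of bases in
the handle slide rests on this. -/

namespace UnitaryCat

open DaggerCategory (dag)

/-! ### Dagger categories -/

section Dagger

variable {C : Type u} [Category.{v} C] [DaggerCategory C]

theorem dag_dag {X Y : C} (f : X ⟶ Y) : dag (dag f) = f := DaggerCategory.dag_dag f

theorem dag_comp {X Y Z : C} (f : X ⟶ Y) (g : Y ⟶ Z) : dag (f ≫ g) = dag g ≫ dag f :=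
  DaggerCategory.dag_comp f g

theorem dag_id (X : C) : dag (𝟙 X) = 𝟙 X := by
  have h := dag_comp (dag (𝟙 X)) (𝟙 X)
  rw [Category.comp_id, dag_dag, Category.comp_id] at h
  exact h.symm

end Dagger

theorem id_ne_zero_of_finrank {C : Type u} [Category.{v} C] [Preadditive C] [Linear ℂ C]
    {X : C} (h : Module.finrank ℂ (X ⟶ X) = 1) : 𝟙 X ≠ 0 := by
  intro h0
  have : Subsingleton (X ⟶ X) := ⟨fun f g => by
    rw [← Category.comp_id f, ← Category.comp_id g, h0, Limits.comp_zero, Limits.comp_zero]⟩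
  rw [Module.finrank_zero_of_subsingleton] at h
  exact zero_ne_one h

theorem exists_eq_smul_id {C : Type u} [Category.{v} C] [Preadditive C] [Linear ℂ C]
    {X : C} (h : Module.finrank ℂ (X ⟶ X) = 1) (f : X ⟶ X) :
    ∃ c : ℂ, f = c • 𝟙 X := by
  obtain ⟨c, hc⟩ := exists_smul_eq_of_finrank_eq_one h (id_ne_zero_of_finrank h) f
  exact ⟨c, hc.symm⟩

/-! ### Endomorphism `C*`-algebras and range projections -/

section CStar

variable {C : Type u} [Category.{v} C] [Preadditive C] [Linear ℂ C] [CStarCategory C]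

theorem dag_add {X Y : C} (f g : X ⟶ Y) : dag (f + g) = dag f + dag g :=
  CStarCategory.dag_add f g

theorem dag_smul {X Y : C} (z : ℂ) (f : X ⟶ Y) :
    dag (z • f) = (starRingEnd ℂ) z • dag f :=
  CStarCategory.dag_smul z f

theorem dag_zero (X Y : C) : dag (0 : X ⟶ Y) = 0 := by
  simpa using dag_smul (0 : ℂ) (0 : X ⟶ Y)

theorem dag_sub {X Y : C} (f g : X ⟶ Y) : dag (f - g) = dag f - dag g := by
  rw [eq_sub_iff_add_eq, ← dag_add, sub_add_cancel]

theorem eq_zero_of_comp_dag_eq_zero {X Y : C} {f : X ⟶ Y} (h : f ≫ dag f = 0) : f = 0 := by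
  let := CStarCategory.homNorm X X
  let := CStarCategory.homNorm X Y
  have h1 := CStarCategory.norm_comp_dag f
  have h2 := ((CStarCategory.normedSpaceCore X X).norm_eq_zero_iff _).2 h
  rw [h2] at h1
  exact ((CStarCategory.normedSpaceCore X Y).norm_eq_zero_iff _).1
    ((pow_eq_zero_iff two_ne_zero).1 h1.symm)

theorem eq_zero_of_dag_comp_eq_zero {X Y : C} {f : X ⟶ Y} (h : dag f ≫ f = 0) : f = 0 := by
  have h' : dag f ≫ dag (dag f) = 0 := by rwa [dag_dag]
  rw [← dag_dag f, eq_zero_of_comp_dag_eq_zero h', dag_zero]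

/-- The norm on the endomorphisms of an object of a `C*`-category. -/
noncomputable abbrev endNormedRing (X : C) : NormedRing (End X) :=
  letI : Norm (End X) := CStarCategory.homNorm X X
  letI g : NormedAddCommGroup (End X) :=
    NormedAddCommGroup.ofCore (CStarCategory.normedSpaceCore X X)
  { (inferInstance : Ring (End X)) with
    norm := g.norm
    dist := g.dist
    dist_self := g.dist_self
    dist_comm := g.dist_comm
    dist_triangle := g.dist_triangle
    edist := g.edist
    edist_dist := g.edist_dist
    toUniformSpace := g.toUniformSpace
    uniformity_dist := g.uniformity_dist
    toBornology := g.toBornology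
    cobounded_sets := g.cobounded_sets
    eq_of_dist_eq_zero := g.eq_of_dist_eq_zero
    dist_eq := g.dist_eq
    -- Multiplication in `End X` is composition in the opposite order, hence the swapped arguments.
    norm_mul_le := fun a b => (CStarCategory.norm_comp_le b a).trans (mul_comm _ _).le }

/-- The dagger as a star operation on the endomorphisms of an object. -/
abbrev endStarRing (X : C) : StarRing (End X) where
  star a := dag (X := X) (Y := X) a
  star_involutive a := dag_dag (X := X) (Y := X) a
  star_mul a b := dag_comp (X := X) (Y := X) b a
  star_add a b := dag_add (X := X) (Y := X) a b

/-- The endomorphisms of an object of a `C*`-category form a `C*`-algebra. -/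
noncomputable abbrev endCStarAlgebra (X : C) : CStarAlgebra (End X) :=
  { endNormedRing X, endStarRing X, (inferInstance : Algebra ℂ (End X)) with
    complete := (CStarCategory.complete X X).complete
    norm_smul_le := fun z a =>
      let := CStarCategory.homNorm X X
      ((CStarCategory.normedSpaceCore X X).norm_smul z a).le
    norm_mul_self_le := fun a => by
      have h := CStarCategory.norm_comp_dag (X := X) (Y := X) a
      exact ((sq _).symm.trans h.symm).le
    star_smul := fun z a => dag_smul (X := X) (Y := X) z a }

theorem finite_spectrum_of_finiteDimensional {A : Type*} [Ring A] [Algebra ℂ A]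
    [FiniteDimensional ℂ A] (a : A) : (spectrum ℂ a).Finite := by
  rcases subsingleton_or_nontrivial A with h | h
  · simp
  refine (Polynomial.rootSet_finite (minpoly ℂ a) ℂ).subset fun z hz => ?_
  have h1 := spectrum.subset_polynomial_aeval a (minpoly ℂ a) ⟨z, hz, rfl⟩
  rw [minpoly.aeval, spectrum.zero_eq] at h1
  rw [Polynomial.mem_rootSet]
  exact ⟨minpoly.ne_zero (Algebra.IsIntegral.isIntegral a), by simpa using h1⟩

/-- The spectrum is finite, so every function on it is continuous and can be applied to `b`. Since
`0⁻¹ = 0`, the function `x * x⁻¹` is the indicator of the nonzero spectrum and yields the range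
projection. -/
theorem exists_projection_of_isSelfAdjoint {A : Type*} [CStarAlgebra A] [FiniteDimensional ℂ A]
    (b : A) (hb : IsSelfAdjoint b) :
    ∃ p b' : A, IsSelfAdjoint p ∧ p * p = p ∧ p = b * b' ∧ b * p = b := by
  have hc (f : ℂ → ℂ) : ContinuousOn f (spectrum ℂ b) :=
    (finite_spectrum_of_finiteDimensional b).continuousOn f
  have hn : IsStarNormal b := hb.isStarNormal
  have hid : cfc (fun x : ℂ => x) b = b := cfc_id' ℂ b
  refine ⟨cfc (fun x : ℂ => x * x⁻¹) b, cfc (fun x : ℂ => x⁻¹) b, ?_, ?_, ?_, ?_⟩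
  · rw [isSelfAdjoint_iff, ← cfc_star]
    congr 1
    ext x
    by_cases hx : x = 0 <;> simp [hx]
  · rw [← cfc_mul _ _ b (hc _) (hc _)]
    congr 1
    ext x
    by_cases hx : x = 0 <;> simp [hx]
  · rw [cfc_mul _ _ b (hc _) (hc _), hid]
  · nth_rw 1 [← hid]
    rw [← cfc_mul _ _ b (hc _) (hc _)]
    nth_rw 2 [← hid]
    congr 1
    ext x
    by_cases hx : x = 0 <;> simp [hx]

/-- A self-adjoint endomorphism has a range projection. -/
theorem exists_projection_of_dag_eq {X : C} [FiniteDimensional ℂ (X ⟶ X)] (b : X ⟶ X)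
    (hb : dag b = b) :
    ∃ p b' : X ⟶ X, dag p = p ∧ p ≫ p = p ∧ p = b' ≫ b ∧ p ≫ b = b := by
  let := endCStarAlgebra X
  have : FiniteDimensional ℂ (End X) := ‹FiniteDimensional ℂ (X ⟶ X)›
  exact exists_projection_of_isSelfAdjoint (A := End X) b hb

end CStar

/-! ### Schur's lemma and simple objects -/

section Simple

variable {C : Type u} [Category.{v} C] [Preadditive C] [Linear ℂ C]
  [MonoidalCategory C] [MonoidalPreadditive C] [MonoidalLinear ℂ C] [RigidCategory C]
  [UnitaryTensorCategory C]

instance finiteDimensional_hom (X Y : C) : FiniteDimensional ℂ (X ⟶ Y) :=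
  UnitaryTensorCategory.finiteDimensional_hom X Y

/-- Kernels are not assumed to exist; split range projections replace them. -/
theorem mono_of_simple_of_ne_zero {X Y : C} [Simple X] {g : X ⟶ Y} (hg : g ≠ 0) : Mono g := by
  refine Preadditive.mono_of_cancel_zero g fun {W} h hh => ?_
  -- The range projection of `dag h ≫ h` is killed by `g`. Its splitting is a subobject of `X` that
  -- cannot be all of `X`, so it vanishes.
  obtain ⟨p, b, hp, hpp, hpb, hb⟩ := exists_projection_of_dag_eq (dag h ≫ h)
    (by rw [dag_comp, dag_dag])
  obtain ⟨Y', w, hw, hwp⟩ := UnitaryTensorCategory.projection_split p hpp hp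
  have : Mono w := by
    have : IsSplitMono w := ⟨⟨dag w, hw⟩⟩
    infer_instance
  have hwg : w ≫ g = 0 := by
    calc w ≫ g = (w ≫ dag w) ≫ w ≫ g := by rw [hw, Category.id_comp]
      _ = w ≫ (dag w ≫ w) ≫ g := by simp only [Category.assoc]
      _ = 0 := by simp [hwp, hpb, hh]
  have hw0 : w = 0 := by
    by_contra hne
    have : IsIso w := (Simple.mono_isIso_iff_nonzero w).2 hne
    exact hg (by rw [← cancel_epi w, hwg, Limits.comp_zero])
  apply eq_zero_of_dag_comp_eq_zero
  rw [← hb, ← hwp, hw0]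
  simp

theorem isIso_of_simple_of_ne_zero {X Y : C} [Simple X] [Simple Y] {g : X ⟶ Y} (hg : g ≠ 0) :
    IsIso g :=
  have := mono_of_simple_of_ne_zero hg
  (Simple.mono_isIso_iff_nonzero g).2 hg

theorem eq_zero_of_not_iso {X Y : C} [Simple X] [Simple Y] (h : ¬ Nonempty (X ≅ Y))
    (g : X ⟶ Y) : g = 0 := by
  by_contra hg
  have := isIso_of_simple_of_ne_zero hg
  exact h ⟨asIso g⟩

theorem finrank_end_of_simple (X : C) [Simple X] : Module.finrank ℂ (X ⟶ X) = 1 := by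
  refine finrank_endomorphism_eq_one ℂ fun f => ⟨fun h h0 => ?_, isIso_of_simple_of_ne_zero⟩
  subst h0
  exact id_nonzero X (by rw [← IsIso.hom_inv_id (0 : X ⟶ X), Limits.zero_comp])

/-- The projection onto a simple summand is a scalar, and a nonzero idempotent scalar is `1`; so the
summand is everything. -/
theorem simple_of_finrank_end {X : C} (h : Module.finrank ℂ (X ⟶ X) = 1) : Simple X := by
  obtain ⟨n, S, s, hS, hs⟩ := UnitaryTensorCategory.semisimple X
  have hn : n ≠ 0 := by
    rintro rfl
    exact id_ne_zero_of_finrank h (by simpa using hs.sum_eq.symm)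
  let i : Fin n := ⟨0, Nat.pos_of_ne_zero hn⟩
  have := hS i
  obtain ⟨c, hc⟩ := exists_eq_smul_id h (dag (s i) ≫ s i)
  have h1 : s i = c • s i := by
    calc s i = (s i ≫ dag (s i)) ≫ s i := by rw [hs.isometry, Category.id_comp]
      _ = c • s i := by rw [Category.assoc, hc, Linear.comp_smul, Category.comp_id]
  have hsi : s i ≠ 0 := by
    intro h0
    apply id_nonzero (S i)
    rw [← hs.isometry, h0, Limits.zero_comp]
  have hc1 : c = 1 := by
    by_contra hne
    have h2 : (1 - c) • s i = 0 := by rw [sub_smul, one_smul, ← h1, sub_self]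
    exact hsi ((smul_eq_zero.1 h2).resolve_left (sub_ne_zero.2 (Ne.symm hne)))
  rw [hc1, one_smul] at hc
  exact Simple.of_iso (⟨dag (s i), s i, hc, hs.isometry i⟩ : X ≅ S i)

instance simple_unit : Simple (𝟙_ C) :=
  simple_of_finrank_end UnitaryTensorCategory.finrank_unit

/-- A nonzero morphism to a simple object is split epi. -/
theorem exists_retract_of_ne_zero {X Y : C} [Simple X] {f : Y ⟶ X} (hf : f ≠ 0) :
    Nonempty (Retract X Y) := by
  obtain ⟨c, hc⟩ := exists_eq_smul_id (finrank_end_of_simple X) (dag f ≫ f)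
  have hc0 : c ≠ 0 := by
    rintro rfl
    exact hf (eq_zero_of_dag_comp_eq_zero (by simpa using hc))
  exact ⟨⟨c⁻¹ • dag f, f, by rw [Linear.smul_comp, hc, smul_smul, inv_mul_cancel₀ hc0, one_smul]⟩⟩

/-- The scalar by which an endomorphism of an object with one-dimensional endomorphism space
acts, and a default value for endomorphisms that are not multiples of the identity. -/
noncomputable def scalar {X : C} (f : X ⟶ X) : ℂ :=
  open Classical in if h : ∃ c : ℂ, f = c • 𝟙 X then h.choose else 0

theorem eq_scalar_smul {X : C} [Simple X] (f : X ⟶ X) : f = scalar f • 𝟙 X := by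
  have h := exists_eq_smul_id (finrank_end_of_simple X) f
  rw [scalar, dif_pos h]
  exact h.choose_spec

theorem scalar_eq {X : C} [Simple X] {f : X ⟶ X} {c : ℂ} (h : f = c • 𝟙 X) : scalar f = c := by
  have h1 : scalar f • 𝟙 X = c • 𝟙 X := by rw [← eq_scalar_smul f, h]
  exact smul_left_injective ℂ (id_nonzero X) h1

end Simple

/-! ### Planar calculus of exact pairings -/

section Monoidal

variable {C : Type u} [Category.{v} C] [MonoidalCategory C]

theorem tensor_coevaluation_eq (X₁ Y₁ X₂ Y₂ : C) [ExactPairing X₁ Y₁] [ExactPairing X₂ Y₂] :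
    η_ (X₁ ⊗ X₂) (Y₂ ⊗ Y₁) = η_ X₁ Y₁ ≫ ((ρ_ X₁).inv ≫ X₁ ◁ η_ X₂ Y₂ ≫ (α_ X₁ X₂ Y₂).inv) ▷ Y₁ ≫
      (α_ (X₁ ⊗ X₂) Y₂ Y₁).hom := by
  rw [ExactPairing.tensor_coevaluation]
  monoidal

theorem tensor_evaluation_eq (X₁ Y₁ X₂ Y₂ : C) [ExactPairing X₁ Y₁] [ExactPairing X₂ Y₂] :
    ε_ (X₁ ⊗ X₂) (Y₂ ⊗ Y₁) = (α_ Y₂ Y₁ (X₁ ⊗ X₂)).hom ≫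
      Y₂ ◁ ((α_ Y₁ X₁ X₂).inv ≫ ε_ X₁ Y₁ ▷ X₂ ≫ (λ_ X₂).hom) ≫ ε_ X₂ Y₂ := by
  rw [ExactPairing.tensor_evaluation]
  monoidal

/-- Closures on opposite sides do not interact: both expressions are one planar diagram, up to two
interchanges. -/
theorem close_left_right_comm {X₁ X₂ Y₁ Y₂ : C} (a : 𝟙_ C ⟶ Y₁ ⊗ X₁) (a' : Y₁ ⊗ X₁ ⟶ 𝟙_ C)
    (b : 𝟙_ C ⟶ X₂ ⊗ Y₂) (b' : X₂ ⊗ Y₂ ⟶ 𝟙_ C) (f : X₁ ⊗ X₂ ⟶ X₁ ⊗ X₂) :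
    a ≫ Y₁ ◁ ((ρ_ X₁).inv ≫ X₁ ◁ b ≫ (α_ _ _ _).inv ≫ f ▷ Y₂ ≫ (α_ _ _ _).hom ≫
      X₁ ◁ b' ≫ (ρ_ X₁).hom) ≫ a' =
    b ≫ ((λ_ X₂).inv ≫ a ▷ X₂ ≫ (α_ _ _ _).hom ≫ Y₁ ◁ f ≫ (α_ _ _ _).inv ≫
      a' ▷ X₂ ≫ (λ_ X₂).hom) ▷ Y₂ ≫ b' := by
  calc
    _ = 𝟙 _ ⊗≫ (a ▷ 𝟙_ C ≫ (Y₁ ⊗ X₁) ◁ b) ⊗≫ Y₁ ◁ f ▷ Y₂ ⊗≫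
        ((Y₁ ⊗ X₁) ◁ b' ≫ a' ▷ 𝟙_ C) ⊗≫ 𝟙 _ := by monoidal
    _ = 𝟙 _ ⊗≫ (𝟙_ C ◁ b ≫ a ▷ (X₂ ⊗ Y₂)) ⊗≫ Y₁ ◁ f ▷ Y₂ ⊗≫
        (a' ▷ (X₂ ⊗ Y₂) ≫ 𝟙_ C ◁ b') ⊗≫ 𝟙 _ := by
      rw [whisker_exchange, whisker_exchange]
    _ = _ := by monoidal

/-- Mates are needed for arbitrary pairings, not only for the chosen duals of the rigid structure.
-/
theorem exists_mate {X X' W W' : C} [ExactPairing X X'] [ExactPairing W W'] (f : X ⟶ W) :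
    ∃ m : W' ⟶ X', η_ W W' ≫ W ◁ m = η_ X X' ≫ f ▷ X' ∧ m ▷ X ≫ ε_ X X' = W' ◁ f ≫ ε_ W W' := by
  let : HasRightDual X := ⟨X'⟩
  let : HasRightDual W := ⟨W'⟩
  exact ⟨rightAdjointMate f, coevaluation_comp_rightAdjointMate f,
    rightAdjointMate_comp_evaluation f⟩

theorem exists_mate_eq {X X' W W' : C} [ExactPairing X X'] [ExactPairing W W'] (m : W' ⟶ X') :
    ∃ f : X ⟶ W, η_ W W' ≫ W ◁ m = η_ X X' ≫ f ▷ X' ∧ m ▷ X ≫ ε_ X X' = W' ◁ f ≫ ε_ W W' := by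
  let : HasLeftDual X' := ⟨X⟩
  let : HasLeftDual W' := ⟨W⟩
  exact ⟨leftAdjointMate m, (coevaluation_comp_leftAdjointMate m).symm,
    (leftAdjointMate_comp_evaluation m).symm⟩

theorem coevaluation_whiskerRight_injective {X X' W : C} [ExactPairing X X'] {f g : X ⟶ W}
    (h : η_ X X' ≫ f ▷ X' = η_ X X' ≫ g ▷ X') : f = g := by
  have h' := congrArg (tensorRightHomEquiv _ X X' _).symm h
  simpa only [tensorRightHomEquiv_symm_coevaluation_comp_whiskerRight, Iso.cancel_iso_hom_left]
    using h'

theorem coevaluation_whiskerLeft_injective {X X' W : C} [ExactPairing X X'] {f g : X' ⟶ W}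
    (h : η_ X X' ≫ X ◁ f = η_ X X' ≫ X ◁ g) : f = g := by
  have h' := congrArg (tensorLeftHomEquiv _ X X' _).symm h
  simpa only [tensorLeftHomEquiv_symm_coevaluation_comp_whiskerLeft, Iso.cancel_iso_hom_left]
    using h'

end Monoidal

/-! ### Left and right traces, and balanced pairings -/

section Trace

variable {C : Type u} [Category.{v} C] [Preadditive C] [Linear ℂ C]
  [MonoidalCategory C] [MonoidalPreadditive C] [MonoidalLinear ℂ C]
  [CStarTensorCategory C]

theorem dag_whiskerLeft (X : C) {Y Z : C} (f : Y ⟶ Z) : dag (X ◁ f) = X ◁ dag f := by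
  rw [← id_tensorHom, CStarTensorCategory.dag_tensorHom, dag_id, id_tensorHom]

theorem dag_whiskerRight {Y Z : C} (f : Y ⟶ Z) (X : C) : dag (f ▷ X) = dag f ▷ X := by
  rw [← tensorHom_id, CStarTensorCategory.dag_tensorHom, dag_id, tensorHom_id]

theorem dag_associator_hom (X Y Z : C) : dag (α_ X Y Z).hom = (α_ X Y Z).inv :=
  CStarTensorCategory.dag_associator X Y Z

theorem dag_associator_inv (X Y Z : C) : dag (α_ X Y Z).inv = (α_ X Y Z).hom := by
  rw [← dag_associator_hom, dag_dag]

theorem dag_leftUnitor_hom (X : C) : dag (λ_ X).hom = (λ_ X).inv :=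
  CStarTensorCategory.dag_leftUnitor X

theorem dag_leftUnitor_inv (X : C) : dag (λ_ X).inv = (λ_ X).hom := by
  rw [← dag_leftUnitor_hom, dag_dag]

theorem dag_rightUnitor_hom (X : C) : dag (ρ_ X).hom = (ρ_ X).inv :=
  CStarTensorCategory.dag_rightUnitor X

theorem dag_rightUnitor_inv (X : C) : dag (ρ_ X).inv = (ρ_ X).hom := by
  rw [← dag_rightUnitor_hom, dag_dag]

attribute [simp] dag_dag dag_comp dag_id dag_whiskerLeft dag_whiskerRight dag_associator_hom
  dag_associator_inv dag_leftUnitor_hom dag_leftUnitor_inv dag_rightUnitor_hom dag_rightUnitor_inv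

/-- The right trace of an endomorphism with respect to an exact pairing. -/
def rightTrace (X Y : C) [ExactPairing X Y] (f : X ⟶ X) : 𝟙_ C ⟶ 𝟙_ C :=
  η_ X Y ≫ f ▷ Y ≫ dag (η_ X Y)

/-- The left trace of an endomorphism with respect to an exact pairing. -/
def leftTrace (X Y : C) [ExactPairing X Y] (f : X ⟶ X) : 𝟙_ C ⟶ 𝟙_ C :=
  dag (ε_ X Y) ≫ Y ◁ f ≫ ε_ X Y

/-- An exact pairing is balanced if its right and left traces agree. -/
class IsBalanced (X Y : C) [ExactPairing X Y] : Prop where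
  rightTrace_eq : ∀ f : X ⟶ X, rightTrace X Y f = leftTrace X Y f

/-- The partial trace over the right tensor factor. -/
def rightPartialTrace (Y Y' : C) [ExactPairing Y Y'] {X X' : C} (g : X ⊗ Y ⟶ X' ⊗ Y) : X ⟶ X' :=
  (ρ_ X).inv ≫ X ◁ η_ Y Y' ≫ (α_ X Y Y').inv ≫ g ▷ Y' ≫ (α_ X' Y Y').hom ≫
    X' ◁ dag (η_ Y Y') ≫ (ρ_ X').hom

/-- The partial trace over the left tensor factor. -/
def leftPartialTrace (Y Y' : C) [ExactPairing Y Y'] {X X' : C} (g : Y ⊗ X ⟶ Y ⊗ X') : X ⟶ X' :=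
  (λ_ X).inv ≫ dag (ε_ Y Y') ▷ X ≫ (α_ Y' Y X).hom ≫ Y' ◁ g ≫ (α_ Y' Y X').inv ≫
    ε_ Y Y' ▷ X' ≫ (λ_ X').hom

/-- The dagger of an exact pairing is an exact pairing in the opposite order. -/
abbrev dagPairing (X Y : C) [ExactPairing X Y] : ExactPairing Y X where
  coevaluation' := dag (ε_ X Y)
  evaluation' := dag (η_ X Y)
  coevaluation_evaluation' := by
    have h := congrArg dag (ExactPairing.evaluation_coevaluation X Y)
    simpa only [dag_comp, dag_whiskerLeft, dag_whiskerRight, dag_associator_hom,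
      dag_leftUnitor_hom, dag_rightUnitor_inv, Category.assoc] using h
  evaluation_coevaluation' := by
    have h := congrArg dag (ExactPairing.coevaluation_evaluation X Y)
    simpa only [dag_comp, dag_whiskerLeft, dag_whiskerRight, dag_associator_inv,
      dag_rightUnitor_hom, dag_leftUnitor_inv, Category.assoc] using h

/-- When all endomorphisms of `Y` are scalars, balance need only be tested on the identity, where
the dagger merely exchanges the two loops. -/
theorem isBalanced_dagPairing (X Y : C) [ExactPairing X Y] [IsBalanced X Y]
    (h : ∀ f : Y ⟶ Y, ∃ c : ℂ, f = c • 𝟙 Y) : @IsBalanced C _ _ _ _ _ _ _ Y X (dagPairing X Y) := by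
  let := dagPairing X Y
  have hb := IsBalanced.rightTrace_eq (X := X) (Y := Y) (𝟙 X)
  refine ⟨fun f => ?_⟩
  obtain ⟨c, rfl⟩ := h f
  have h1 : η_ X Y ≫ dag (η_ X Y) = dag (ε_ X Y) ≫ ε_ X Y := by
    simpa [rightTrace, leftTrace] using hb
  have h2 : η_ Y X = dag (ε_ X Y) := rfl
  have h3 : ε_ Y X = dag (η_ X Y) := rfl
  simp [rightTrace, leftTrace, h1, h2, h3]

theorem rightTrace_tensor (X₁ Y₁ X₂ Y₂ : C) [ExactPairing X₁ Y₁] [ExactPairing X₂ Y₂]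
    (f : X₁ ⊗ X₂ ⟶ X₁ ⊗ X₂) :
    rightTrace (X₁ ⊗ X₂) (Y₂ ⊗ Y₁) f = rightTrace X₁ Y₁ (rightPartialTrace X₂ Y₂ f) := by
  simp only [rightTrace, rightPartialTrace, tensor_coevaluation_eq, dag_comp, dag_whiskerLeft,
    dag_whiskerRight, dag_associator_hom, dag_rightUnitor_inv, dag_associator_inv]
  monoidal

theorem leftTrace_tensor (X₁ Y₁ X₂ Y₂ : C) [ExactPairing X₁ Y₁] [ExactPairing X₂ Y₂]
    (f : X₁ ⊗ X₂ ⟶ X₁ ⊗ X₂) :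
    leftTrace (X₁ ⊗ X₂) (Y₂ ⊗ Y₁) f = leftTrace X₂ Y₂ (leftPartialTrace X₁ Y₁ f) := by
  simp only [leftTrace, leftPartialTrace, tensor_evaluation_eq, dag_comp, dag_whiskerLeft,
    dag_whiskerRight, dag_associator_hom, dag_leftUnitor_hom, dag_associator_inv]
  monoidal

theorem leftTrace_rightPartialTrace (X₁ Y₁ X₂ Y₂ : C) [ExactPairing X₁ Y₁] [ExactPairing X₂ Y₂]
    (f : X₁ ⊗ X₂ ⟶ X₁ ⊗ X₂) :
    leftTrace X₁ Y₁ (rightPartialTrace X₂ Y₂ f) = rightTrace X₂ Y₂ (leftPartialTrace X₁ Y₁ f) :=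
  close_left_right_comm _ _ _ _ f

instance isBalanced_tensor (X₁ Y₁ X₂ Y₂ : C) [ExactPairing X₁ Y₁] [ExactPairing X₂ Y₂]
    [IsBalanced X₁ Y₁] [IsBalanced X₂ Y₂] : IsBalanced (X₁ ⊗ X₂) (Y₂ ⊗ Y₁) where
  rightTrace_eq f := by
    rw [rightTrace_tensor, leftTrace_tensor, IsBalanced.rightTrace_eq,
      leftTrace_rightPartialTrace, IsBalanced.rightTrace_eq]

theorem rightTrace_dag (X Y : C) [ExactPairing X Y] (f : X ⟶ X) :
    rightTrace X Y (dag f) = dag (rightTrace X Y f) := by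
  simp [rightTrace]

theorem rightTrace_add (X Y : C) [ExactPairing X Y] (f g : X ⟶ X) :
    rightTrace X Y (f + g) = rightTrace X Y f + rightTrace X Y g := by
  simp [rightTrace]

theorem rightTrace_sub (X Y : C) [ExactPairing X Y] (f g : X ⟶ X) :
    rightTrace X Y (f - g) = rightTrace X Y f - rightTrace X Y g := by
  rw [eq_sub_iff_add_eq, ← rightTrace_add, sub_add_cancel]

theorem rightTrace_smul (X Y : C) [ExactPairing X Y] (z : ℂ) (f : X ⟶ X) :
    rightTrace X Y (z • f) = z • rightTrace X Y f := by
  simp [rightTrace]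

theorem rightTrace_comp_dag (X Y : C) [ExactPairing X Y] {W : C} (f : X ⟶ W) :
    rightTrace X Y (f ≫ dag f) = (η_ X Y ≫ f ▷ Y) ≫ dag (η_ X Y ≫ f ▷ Y) := by
  simp [rightTrace]

end Trace

/-! ### Traciality and existence of balanced pairings -/

section Tracial

variable {C : Type u} [Category.{v} C] [Preadditive C] [Linear ℂ C]
  [MonoidalCategory C] [MonoidalPreadditive C] [MonoidalLinear ℂ C] [RigidCategory C]
  [UnitaryTensorCategory C]

theorem exists_comp_dag_eq_normSq {X : C} (x : 𝟙_ C ⟶ X) :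
    ∃ r : ℝ, 0 ≤ r ∧ x ≫ dag x = (r : ℂ) • 𝟙 (𝟙_ C) := by
  obtain ⟨g, hg⟩ := CStarCategory.positive x
  obtain ⟨c, rfl⟩ := exists_eq_smul_id UnitaryTensorCategory.finrank_unit g
  refine ⟨Complex.normSq c, Complex.normSq_nonneg c, ?_⟩
  rw [hg, dag_smul, dag_id, Linear.smul_comp, Linear.comp_smul, smul_smul, Category.comp_id,
    Complex.mul_conj]

theorem eq_zero_of_comp_dag_add_eq_zero {X Y : C} (x : 𝟙_ C ⟶ X) (y : 𝟙_ C ⟶ Y)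
    (h : x ≫ dag x + y ≫ dag y = 0) : x = 0 := by
  obtain ⟨r, hr, hx⟩ := exists_comp_dag_eq_normSq x
  obtain ⟨s, hs, hy⟩ := exists_comp_dag_eq_normSq y
  rw [hx, hy, ← add_smul] at h
  have h1 := (smul_eq_zero.1 h).resolve_right
    (id_ne_zero_of_finrank UnitaryTensorCategory.finrank_unit)
  have h2 : r + s = 0 := by exact_mod_cast h1
  have h3 : r = 0 := by linarith
  apply eq_zero_of_comp_dag_eq_zero
  rw [hx, h3]
  simp

/-- The traces of balanced pairings are tracial. -/
theorem rightTrace_comp_comm (X X' W W' : C) [ExactPairing X X'] [ExactPairing W W']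
    [IsBalanced X X'] [IsBalanced W W'] (f : X ⟶ W) (k : W ⟶ X) :
    rightTrace X X' (f ≫ k) = rightTrace W W' (k ≫ f) := by
  obtain ⟨t, ht, ht'⟩ := exists_mate (X' := W') (W' := X') (dag f)
  obtain ⟨f₁, hf, hf'⟩ := exists_mate_eq (X := X) (W := W) (dag t)
  -- `f₁` is `f` transported by dagger, mate, dagger and mate again. Moving `f` around the loop
  -- turns it into `f₁`, so traciality amounts to `f₁ = f`. `e₁` uses only coevaluations; `e₂` uses
  -- evaluations and hence the balance.
  have e₁ (h : W ⟶ X) : rightTrace W W' (h ≫ f) = rightTrace X X' (f₁ ≫ h) := by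
    have h2 : f ▷ W' ≫ dag (η_ W W') = X ◁ dag t ≫ dag (η_ X X') := by
      simpa using (congrArg dag ht).symm
    calc rightTrace W W' (h ≫ f) = η_ W W' ≫ h ▷ W' ≫ f ▷ W' ≫ dag (η_ W W') := by
          simp [rightTrace]
      _ = (η_ W W' ≫ W ◁ dag t) ≫ h ▷ X' ≫ dag (η_ X X') := by
          rw [h2, ← whisker_exchange_assoc, Category.assoc]
      _ = _ := by rw [hf]; simp [rightTrace]
  have e₂ (h : X ⟶ W) : rightTrace W W' (dag f₁ ≫ h) = rightTrace X X' (h ≫ dag f) := by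
    have h2 : dag (ε_ W W') ≫ W' ◁ dag f₁ = dag (ε_ X X') ≫ t ▷ X := by
      simpa using (congrArg dag hf').symm
    rw [IsBalanced.rightTrace_eq, IsBalanced.rightTrace_eq]
    calc leftTrace W W' (dag f₁ ≫ h) = (dag (ε_ W W') ≫ W' ◁ dag f₁) ≫ W' ◁ h ≫ ε_ W W' := by
          simp [leftTrace]
      _ = dag (ε_ X X') ≫ X' ◁ h ≫ t ▷ W ≫ ε_ W W' := by
          rw [h2, Category.assoc, whisker_exchange_assoc]
      _ = _ := by rw [ht']; simp [leftTrace]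
  -- The squared norms of `f₁ - f` under both traces add up to zero by `e₁`, `e₂` and their daggers.
  -- Both terms are nonnegative, so they vanish.
  have hff₁ : f₁ = f := by
    have a₁ := e₁ (dag f)
    have a₂ := e₂ f
    have a₃ := e₂ f₁
    have a₄ := e₁ (dag f₁)
    have a₅ := congrArg dag a₁
    have a₆ := congrArg dag a₂
    simp only [← rightTrace_dag, dag_comp, dag_dag] at a₅ a₆
    have hz : rightTrace X X' ((f₁ - f) ≫ dag (f₁ - f)) +
        rightTrace W W' (dag (f₁ - f) ≫ dag (dag (f₁ - f))) = 0 := by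
      simp only [dag_dag, dag_sub, Preadditive.comp_sub, Preadditive.sub_comp, rightTrace_sub]
      rw [a₆, a₂, a₃, ← a₄, a₂, ← a₅, ← a₁]
      abel
    rw [rightTrace_comp_dag, rightTrace_comp_dag] at hz
    have h0 := eq_zero_of_comp_dag_add_eq_zero _ _ hz
    refine coevaluation_whiskerRight_injective (X' := X') ?_
    calc η_ X X' ≫ f₁ ▷ X' = η_ X X' ≫ ((f₁ - f) + f) ▷ X' := by rw [sub_add_cancel]
      _ = _ := by rw [MonoidalPreadditive.add_whiskerRight, Preadditive.comp_add, h0, zero_add]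
  rw [e₁ k, hff₁]

/-- Taking mates matches endomorphisms of `X'` with those of `X`, which are scalars. -/
theorem simple_of_exactPairing (X X' : C) [ExactPairing X X'] [Simple X] : Simple X' := by
  refine simple_of_finrank_end (finrank_eq_one (𝟙 X') ?_ fun f => ?_)
  · intro h0
    have h1 : η_ X X' = 0 := by
      rw [← Category.comp_id (η_ X X'), ← whiskerLeft_id, h0]
      simp
    exact id_nonzero X (coevaluation_whiskerRight_injective (X' := X') (by simp [h1]))
  · obtain ⟨g, hg, -⟩ := exists_mate_eq (X := X) (W := X) f
    obtain ⟨c, rfl⟩ := exists_eq_smul_id (finrank_end_of_simple X) g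
    exact ⟨c, coevaluation_whiskerLeft_injective (X := X) (by rw [hg]; simp)⟩

/-- Rescaling the coevaluation and the evaluation of an exact pairing. -/
noncomputable abbrev scalePairing (X X' : C) [ExactPairing X X'] {c : ℂ} (hc : c ≠ 0) : ExactPairing X X' where
  coevaluation' := c • η_ X X'
  evaluation' := c⁻¹ • ε_ X X'
  coevaluation_evaluation' := by simp [smul_smul, hc]
  evaluation_coevaluation' := by simp [smul_smul, hc]

/-- A simple object has a balanced pairing with every dual. -/
theorem exists_balanced_pairing (X X' : C) [Simple X] [e : ExactPairing X X'] :
    ∃ e' : ExactPairing X X', @IsBalanced C _ _ _ _ _ _ _ X X' e' := by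
  obtain ⟨l, hl, hη⟩ := exists_comp_dag_eq_normSq (η_ X X')
  obtain ⟨r, hr, hε⟩ := exists_comp_dag_eq_normSq (dag (ε_ X X'))
  rw [dag_dag] at hε
  have hl0 : l ≠ 0 := by
    rintro rfl
    have h0 : η_ X X' = 0 := eq_zero_of_comp_dag_eq_zero (by simpa using hη)
    exact id_nonzero X (coevaluation_whiskerRight_injective (X' := X') (by simp [h0]))
  have hr0 : r ≠ 0 := by
    rintro rfl
    have h0 : ε_ X X' = 0 := eq_zero_of_dag_comp_eq_zero (by simpa using hε)
    have h1 := ExactPairing.evaluation_coevaluation X X'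
    rw [h0, MonoidalPreadditive.whiskerLeft_zero, Limits.comp_zero, Limits.comp_zero] at h1
    apply id_nonzero X
    calc 𝟙 X = (λ_ X).inv ≫ ((λ_ X).hom ≫ (ρ_ X).inv) ≫ (ρ_ X).hom := by simp
      _ = 0 := by rw [← h1]; simp
  have hpos : 0 < r / l := div_pos (lt_of_le_of_ne hr hr0.symm) (lt_of_le_of_ne hl hl0.symm)
  -- Scaling by `t` multiplies the right loop `l` by `t ^ 2` and the left loop `r` by `t ^ (-2)`;
  -- they agree when `t ^ 4 = r / l`.
  let t : ℝ := √√(r / l)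
  have ht : t ^ 2 * t ^ 2 = r / l := by
    rw [Real.sq_sqrt (Real.sqrt_nonneg _), ← sq, Real.sq_sqrt hpos.le]
  have ht0 : t ≠ 0 := (Real.sqrt_pos.2 (Real.sqrt_pos.2 hpos)).ne'
  have htc : (t : ℂ) ≠ 0 := by exact_mod_cast ht0
  let e' := scalePairing X X' htc
  refine ⟨e', ⟨fun f => ?_⟩⟩
  have h1 : @ExactPairing.coevaluation C _ _ X X' e' = (t : ℂ) • @ExactPairing.coevaluation C _ _ X X' e := rfl
  have h2 : @ExactPairing.evaluation C _ _ X X' e' = (t : ℂ)⁻¹ • @ExactPairing.evaluation C _ _ X X' e := rfl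
  obtain ⟨c, rfl⟩ := exists_eq_smul_id (finrank_end_of_simple X) f
  have h3 : t * t * l = t⁻¹ * t⁻¹ * r := by
    field_simp
    field_simp at ht
    linarith
  have h4 : ((t * t * l : ℝ) : ℂ) = ((t⁻¹ * t⁻¹ * r : ℝ) : ℂ) := by rw [h3]
  push_cast at h4
  simp only [rightTrace, leftTrace, h1, h2, dag_smul, MonoidalLinear.smul_whiskerRight,
    MonoidalLinear.whiskerLeft_smul, id_whiskerRight, whiskerLeft_id, Linear.smul_comp,
    Linear.comp_smul, Category.id_comp, hη, hε, smul_smul, map_inv₀, Complex.conj_ofReal]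
  congr 1
  linear_combination (norm := ring_nf) c * h4

end Tracial

/-! ### Bending strands -/

section Bend

variable {C : Type u} [Category.{v} C] [MonoidalCategory C]

/-- Bending the right tensor factor of the source to the target. -/
def bendRight (Y Y' : C) [ExactPairing Y Y'] {Z K : C} (p : Z ⊗ Y ⟶ K) : Z ⟶ K ⊗ Y' :=
  (ρ_ Z).inv ≫ Z ◁ η_ Y Y' ≫ (α_ Z Y Y').inv ≫ p ▷ Y'

/-- Bending the left tensor factor of the source to the target. -/
def bendLeft (Y Y' : C) [ExactPairing Y Y'] {Z V : C} (s : Y' ⊗ Z ⟶ V) : Z ⟶ Y ⊗ V :=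
  (λ_ Z).inv ≫ η_ Y Y' ▷ Z ≫ (α_ Y Y' Z).hom ≫ Y ◁ s

theorem bendLeft_surjective (Y Y' : C) [ExactPairing Y Y'] {Z V : C} (u : Z ⟶ Y ⊗ V) :
    ∃ s : Y' ⊗ Z ⟶ V, bendLeft Y Y' s = u :=
  (tensorLeftHomEquiv Z Y Y' V).surjective u

/-- The morphism that applies `m` between `u` and `v`. -/
def sandwich {X K V Z : C} (m : X ⊗ K ⟶ X ⊗ K) (u : Z ⟶ K ⊗ V) (v : K ⊗ V ⟶ Z) :
    X ⊗ Z ⟶ X ⊗ Z :=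
  X ◁ u ≫ (α_ X K V).inv ≫ m ▷ V ≫ (α_ X K V).hom ≫ X ◁ v

variable [Preadditive C] [MonoidalPreadditive C]

theorem bendLeft_sum (Y Y' : C) [ExactPairing Y Y'] {Z V : C} {J : Type*} (A : Finset J)
    (s : J → (Y' ⊗ Z ⟶ V)) :
    bendLeft Y Y' (∑ j ∈ A, s j) = ∑ j ∈ A, bendLeft Y Y' (s j) := by
  simp [bendLeft, Preadditive.comp_sum, whiskerLeft_sum]

theorem sandwich_sum_left {X K V Z : C} (m : X ⊗ K ⟶ X ⊗ K) {J : Type*} (A : Finset J)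
    (u : J → (Z ⟶ K ⊗ V)) (v : K ⊗ V ⟶ Z) :
    sandwich m (∑ j ∈ A, u j) v = ∑ j ∈ A, sandwich m (u j) v := by
  simp [sandwich, Preadditive.sum_comp, whiskerLeft_sum]

theorem sandwich_sum_right {X K V Z : C} (m : X ⊗ K ⟶ X ⊗ K) {J : Type*} (A : Finset J)
    (u : Z ⟶ K ⊗ V) (v : J → (K ⊗ V ⟶ Z)) :
    sandwich m u (∑ j ∈ A, v j) = ∑ j ∈ A, sandwich m u (v j) := by
  simp [sandwich, Preadditive.comp_sum, whiskerLeft_sum]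

variable [Linear ℂ C] [MonoidalLinear ℂ C]

theorem bendLeft_smul (Y Y' : C) [ExactPairing Y Y'] {Z V : C} (c : ℂ) (s : Y' ⊗ Z ⟶ V) :
    bendLeft Y Y' (c • s) = c • bendLeft Y Y' s := by
  simp [bendLeft]

theorem sandwich_smul_left {X K V Z : C} (m : X ⊗ K ⟶ X ⊗ K) (c : ℂ) (u : Z ⟶ K ⊗ V)
    (v : K ⊗ V ⟶ Z) : sandwich m (c • u) v = c • sandwich m u v := by
  simp [sandwich]

theorem sandwich_smul_right {X K V Z : C} (m : X ⊗ K ⟶ X ⊗ K) (c : ℂ) (u : Z ⟶ K ⊗ V)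
    (v : K ⊗ V ⟶ Z) : sandwich m u (c • v) = c • sandwich m u v := by
  simp [sandwich]

end Bend

/-! ### Bending with daggers, and partial traces -/

section Cobend

variable {C : Type u} [Category.{v} C] [Preadditive C] [Linear ℂ C]
  [MonoidalCategory C] [MonoidalPreadditive C] [MonoidalLinear ℂ C]
  [CStarTensorCategory C]

/-- Bending the right tensor factor of the target to the source. -/
def cobendRight (Y Y' : C) [ExactPairing Y Y'] {Z K : C} (q : K ⟶ Z ⊗ Y) : K ⊗ Y' ⟶ Z :=
  q ▷ Y' ≫ (α_ Z Y Y').hom ≫ Z ◁ dag (η_ Y Y') ≫ (ρ_ Z).hom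

/-- Bending the left tensor factor of the target to the source. -/
def cobendLeft (Y Y' : C) [ExactPairing Y Y'] {Z V : C} (t : V ⟶ Y' ⊗ Z) : Y ⊗ V ⟶ Z :=
  Y ◁ t ≫ (α_ Y Y' Z).inv ≫ dag (η_ Y Y') ▷ Z ≫ (λ_ Z).hom

theorem bendRight_comp_cobendRight (Y Y' : C) [ExactPairing Y Y'] {Z K : C} (p : Z ⊗ Y ⟶ K)
    (q : K ⟶ Z ⊗ Y) :
    bendRight Y Y' p ≫ cobendRight Y Y' q = rightPartialTrace Y Y' (p ≫ q) := by
  simp [bendRight, cobendRight, rightPartialTrace]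

theorem bendLeft_comp_cobendLeft (Y Y' : C) [ExactPairing Y Y'] {Z V : C} (s : Y' ⊗ Z ⟶ V)
    (t : V ⟶ Y' ⊗ Z) :
    bendLeft Y Y' s ≫ cobendLeft Y Y' t =
      @leftPartialTrace C _ _ _ _ _ _ _ Y' Y (dagPairing Y Y') _ _ (s ≫ t) := by
  have h1 : @ExactPairing.evaluation C _ _ Y' Y (dagPairing Y Y') = dag (η_ Y Y') := rfl
  simp [bendLeft, cobendLeft, leftPartialTrace, h1]

theorem cobendRight_surjective (Y Y' : C) [ExactPairing Y Y'] {Z K : C} (v : K ⊗ Y' ⟶ Z) :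
    ∃ q : K ⟶ Z ⊗ Y, cobendRight Y Y' q = v :=
  let := dagPairing Y Y'
  (tensorRightHomEquiv K Y' Y Z).symm.surjective v

theorem cobendRight_sum (Y Y' : C) [ExactPairing Y Y'] {Z K : C} {J : Type*} (A : Finset J)
    (q : J → (K ⟶ Z ⊗ Y)) :
    cobendRight Y Y' (∑ j ∈ A, q j) = ∑ j ∈ A, cobendRight Y Y' (q j) := by
  simp [cobendRight, Preadditive.sum_comp, sum_whiskerRight]

theorem cobendRight_smul (Y Y' : C) [ExactPairing Y Y'] {Z K : C} (c : ℂ) (q : K ⟶ Z ⊗ Y) :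
    cobendRight Y Y' (c • q) = c • cobendRight Y Y' q := by
  simp [cobendRight]

theorem rightPartialTrace_sandwich (Y Y' : C) [ExactPairing Y Y'] {X K Z : C}
    (m : X ⊗ K ⟶ X ⊗ K) (p : Z ⊗ Y ⟶ K) (q : K ⟶ Z ⊗ Y) :
    rightPartialTrace Y Y' ((α_ X Z Y).hom ≫ (X ◁ p ≫ m ≫ X ◁ q) ≫ (α_ X Z Y).inv) =
      sandwich m (bendRight Y Y' p) (cobendRight Y Y' q) := by
  simp only [rightPartialTrace, sandwich, bendRight, cobendRight]
  monoidal

/-- Isolating the product `s ≫ t` lets a sum over a resolution of the identity of `Y' ⊗ Z` collapse.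
-/
theorem sandwich_bendLeft (Y Y' : C) [ExactPairing Y Y'] {X Z V : C}
    (m : X ⊗ Y ⟶ X ⊗ Y) (s : Y' ⊗ Z ⟶ V) (t : V ⟶ Y' ⊗ Z) :
    sandwich m (bendLeft Y Y' s) (cobendLeft Y Y' t) =
      X ◁ bendLeft Y Y' (𝟙 (Y' ⊗ Z)) ≫ (α_ _ _ _).inv ≫ m ▷ _ ≫ (X ⊗ Y) ◁ (s ≫ t) ≫
        (α_ _ _ _).hom ≫ X ◁ cobendLeft Y Y' (𝟙 (Y' ⊗ Z)) := by
  have h1 : bendLeft Y Y' s = bendLeft Y Y' (𝟙 (Y' ⊗ Z)) ≫ Y ◁ s := by simp [bendLeft]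
  have h2 : cobendLeft Y Y' t = Y ◁ t ≫ cobendLeft Y Y' (𝟙 (Y' ⊗ Z)) := by simp [cobendLeft]
  rw [h1, h2, sandwich]
  simp only [MonoidalCategory.whiskerLeft_comp, Category.assoc, ← associator_naturality_right_assoc,
    associator_inv_naturality_right_assoc]
  rw [whisker_exchange_assoc]

theorem rightPartialTrace_whiskerRight (Y Y' : C) [ExactPairing Y Y'] {X Z : C}
    (m : X ⊗ Y ⟶ X ⊗ Y) :
    rightPartialTrace Y Y' m ▷ Z =
      X ◁ bendLeft Y Y' (𝟙 (Y' ⊗ Z)) ≫ (α_ _ _ _).inv ≫ m ▷ _ ≫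
        (α_ _ _ _).hom ≫ X ◁ cobendLeft Y Y' (𝟙 (Y' ⊗ Z)) := by
  simp only [rightPartialTrace, bendLeft, cobendLeft]
  monoidal

theorem whiskerLeft_rightPartialTrace (Y Y' : C) [ExactPairing Y Y'] (Z : C) {X X' : C}
    (m : X ⊗ Y ⟶ X' ⊗ Y) :
    Z ◁ rightPartialTrace Y Y' m =
      rightPartialTrace Y Y' ((α_ Z X Y).hom ≫ Z ◁ m ≫ (α_ Z X' Y).inv) := by
  simp only [rightPartialTrace]
  monoidal

theorem rightPartialTrace_natural (Y Y' : C) [ExactPairing Y Y'] {W X X' W' : C}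
    (a : W ⟶ X) (m : X ⊗ Y ⟶ X' ⊗ Y) (b : X' ⟶ W') :
    rightPartialTrace Y Y' (a ▷ Y ≫ m ≫ b ▷ Y) = a ≫ rightPartialTrace Y Y' m ≫ b := by
  have h1 : a ≫ (ρ_ X).inv ≫ X ◁ η_ Y Y' = (ρ_ W).inv ≫ W ◁ η_ Y Y' ≫ a ▷ _ := by
    rw [whisker_exchange, rightUnitor_inv_naturality_assoc]
  have h2 : X' ◁ dag (η_ Y Y') ≫ (ρ_ X').hom ≫ b = b ▷ _ ≫ W' ◁ dag (η_ Y Y') ≫ (ρ_ W').hom := by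
    rw [← whisker_exchange_assoc, rightUnitor_naturality]
  simp only [rightPartialTrace, Category.assoc, h2]
  rw [reassoc_of% h1]
  simp

theorem rightPartialTrace_smul (Y Y' : C) [ExactPairing Y Y'] {X X' : C} (c : ℂ)
    (f : X ⊗ Y ⟶ X' ⊗ Y) :
    rightPartialTrace Y Y' (c • f) = c • rightPartialTrace Y Y' f := by
  simp [rightPartialTrace]

theorem rightPartialTrace_sum (Y Y' : C) [ExactPairing Y Y'] {X X' : C} {J : Type*}
    (A : Finset J) (f : J → (X ⊗ Y ⟶ X' ⊗ Y)) :
    rightPartialTrace Y Y' (∑ j ∈ A, f j) = ∑ j ∈ A, rightPartialTrace Y Y' (f j) := by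
  simp [rightPartialTrace, Preadditive.sum_comp, Preadditive.comp_sum, sum_whiskerRight]

end Cobend

/-! ### The double braiding -/

section Monodromy

variable {C : Type u} [Category.{v} C] [MonoidalCategory C] [BraidedCategory C]

/-- The double braiding. -/
def monodromy (X Y : C) : X ⊗ Y ⟶ X ⊗ Y := (β_ X Y).hom ≫ (β_ Y X).hom

theorem whiskerRight_monodromy {X X' : C} (f : X ⟶ X') (Y : C) :
    f ▷ Y ≫ monodromy X' Y = monodromy X Y ≫ f ▷ Y := by
  simp [monodromy]

theorem whiskerLeft_monodromy (X : C) {Y Y' : C} (f : Y ⟶ Y') :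
    X ◁ f ≫ monodromy X Y' = monodromy X Y ≫ X ◁ f := by
  simp [monodromy]

theorem monodromy_tensor_right (X Z Y : C) :
    (β_ X Z).hom ▷ Y ≫ ((α_ Z X Y).hom ≫ Z ◁ monodromy X Y ≫ (α_ Z X Y).inv) ≫ (β_ Z X).hom ▷ Y =
      (α_ X Z Y).hom ≫ monodromy X (Z ⊗ Y) ≫ (α_ X Z Y).inv := by
  simp [monodromy]

theorem monodromy_tensor_left (X Z Y : C) :
    monodromy (X ⊗ Z) Y = (α_ X Z Y).hom ≫ X ◁ (β_ Z Y).hom ≫ (α_ X Y Z).inv ≫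
      monodromy X Y ▷ Z ≫ (α_ X Y Z).hom ≫ X ◁ (β_ Y Z).hom ≫ (α_ X Z Y).inv := by
  simp [monodromy]

end Monodromy

/-! ### Dimensions, weighted circles and the handle slide -/

section HandleSlide

variable {C : Type u} [Category.{v} C] [Preadditive C] [Linear ℂ C]
  [MonoidalCategory C] [MonoidalPreadditive C] [MonoidalLinear ℂ C] [RigidCategory C]
  [UnitaryTensorCategory C]

/-- The dimension of an object with respect to an exact pairing. -/
noncomputable def qdim (X X' : C) [ExactPairing X X'] : ℂ := scalar (rightTrace X X' (𝟙 X))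

theorem rightTrace_eq_smul (X X' : C) [ExactPairing X X'] [Simple X] (f : X ⟶ X) :
    rightTrace X X' f = (scalar f * qdim X X') • 𝟙 (𝟙_ C) := by
  conv_lhs => rw [eq_scalar_smul f, rightTrace_smul, eq_scalar_smul (rightTrace X X' (𝟙 X))]
  rw [smul_smul, qdim]

theorem exists_qdim_eq (X X' : C) [ExactPairing X X'] [Simple X] :
    ∃ r : ℝ, 0 < r ∧ qdim X X' = r := by
  obtain ⟨r, hr, h⟩ := exists_comp_dag_eq_normSq (η_ X X')
  have hr0 : r ≠ 0 := by
    rintro rfl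
    have h0 : η_ X X' = 0 := eq_zero_of_comp_dag_eq_zero (by simpa using h)
    exact id_nonzero X (coevaluation_whiskerRight_injective (X' := X') (by simp [h0]))
  refine ⟨r, lt_of_le_of_ne hr hr0.symm, scalar_eq ?_⟩
  rw [← h]
  simp [rightTrace]

theorem qdim_ne_zero (X X' : C) [ExactPairing X X'] [Simple X] : qdim X X' ≠ 0 := by
  obtain ⟨r, hr, h⟩ := exists_qdim_eq X X'
  rw [h]
  exact_mod_cast hr.ne'

theorem qdim_dagPairing (X X' : C) [ExactPairing X X'] [IsBalanced X X'] :
    @qdim C _ _ _ _ _ _ _ _ X' X (dagPairing X X') = qdim X X' := by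
  rw [qdim, qdim, IsBalanced.rightTrace_eq (X := X) (Y := X')]
  have h : @ExactPairing.coevaluation C _ _ X' X (dagPairing X X') = dag (ε_ X X') := rfl
  simp [rightTrace, leftTrace, h]

/-- Traciality compares the composition pairing with the pairing of the bent morphisms; the two
differ by a ratio of dimensions. -/
theorem scalar_comp_mul_qdim_right (Y Y' Z Z' K K' : C) [ExactPairing Y Y'] [ExactPairing Z Z']
    [ExactPairing K K'] [IsBalanced Y Y'] [IsBalanced Z Z'] [IsBalanced K K'] [Simple Z] [Simple K]
    (p : Z ⊗ Y ⟶ K) (q : K ⟶ Z ⊗ Y) :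
    scalar (q ≫ p) * qdim K K' =
      scalar (bendRight Y Y' p ≫ cobendRight Y Y' q) * qdim Z Z' := by
  have h := rightTrace_comp_comm K K' (Z ⊗ Y) (Y' ⊗ Z') q p
  rw [rightTrace_tensor, ← bendRight_comp_cobendRight, rightTrace_eq_smul, rightTrace_eq_smul] at h
  exact smul_left_injective ℂ (id_nonzero (𝟙_ C)) h

theorem scalar_comp_mul_qdim_left (Y Y' Z Z' V V' : C) [ExactPairing Y Y'] [ExactPairing Z Z']
    [ExactPairing V V'] [IsBalanced Y Y'] [IsBalanced Z Z'] [IsBalanced V V'] [Simple Z] [Simple V']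
    [Simple Y'] (s : Y' ⊗ Z ⟶ V') (t : V' ⟶ Y' ⊗ Z) :
    scalar (t ≫ s) * qdim V V' =
      scalar (bendLeft Y Y' s ≫ cobendLeft Y Y' t) * qdim Z Z' := by
  let e₁ := dagPairing Y Y'
  let e₂ := dagPairing V V'
  have b₁ : IsBalanced Y' Y := isBalanced_dagPairing Y Y'
    (exists_eq_smul_id (finrank_end_of_simple Y'))
  have b₂ : IsBalanced V' V := isBalanced_dagPairing V V'
    (exists_eq_smul_id (finrank_end_of_simple V'))
  have h := rightTrace_comp_comm V' V (Y' ⊗ Z) (Z' ⊗ Y) t s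
  rw [IsBalanced.rightTrace_eq (X := Y' ⊗ Z), leftTrace_tensor, ← bendLeft_comp_cobendLeft,
    ← IsBalanced.rightTrace_eq, rightTrace_eq_smul, rightTrace_eq_smul, qdim_dagPairing] at h
  exact smul_left_injective ℂ (id_nonzero (𝟙_ C)) h

theorem rightPartialTrace_id (Y Y' : C) [ExactPairing Y Y'] (X : C) :
    rightPartialTrace Y Y' (𝟙 (X ⊗ Y)) = qdim Y Y' • 𝟙 X := by
  have h : η_ Y Y' ≫ dag (η_ Y Y') = qdim Y Y' • 𝟙 (𝟙_ C) := by
    rw [qdim, ← eq_scalar_smul]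
    simp [rightTrace]
  simp [rightPartialTrace, ← MonoidalCategory.whiskerLeft_comp_assoc, h]

/-- The identity of `X` is a finite sum of morphisms that factor through the objects `T i`. -/
def FactorsThrough {ι : Type*} [Fintype ι] (T : ι → C) (X : C) : Prop :=
  ∃ (n : ℕ) (p : ∀ i, Fin n → (X ⟶ T i)) (q : ∀ i, Fin n → (T i ⟶ X)),
    ∑ i, ∑ a, p i a ≫ q i a = 𝟙 X

variable {ι : Type*} [Fintype ι]

theorem sum_scalar_smul_comp {T : ι → C} [∀ i, Simple (T i)]
    (hT : ∀ i j, i ≠ j → ¬ Nonempty (T i ≅ T j)) {X : C} {n : ℕ}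
    {p : ∀ i, Fin n → (X ⟶ T i)} {q : ∀ i, Fin n → (T i ⟶ X)}
    (h : ∑ i, ∑ a, p i a ≫ q i a = 𝟙 X) (j : ι) (f : X ⟶ T j) :
    f = ∑ a, scalar (q j a ≫ f) • p j a := by
  calc f = (∑ i, ∑ a, p i a ≫ q i a) ≫ f := by rw [h, Category.id_comp]
    _ = ∑ i, ∑ a, p i a ≫ q i a ≫ f := by simp [Preadditive.sum_comp]
    _ = ∑ a, p j a ≫ q j a ≫ f := by
      refine Finset.sum_eq_single j (fun i _ hij => ?_) (by simp)
      refine Finset.sum_eq_zero fun a _ => ?_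
      rw [eq_zero_of_not_iso (hT i j hij) (q i a ≫ f), Limits.comp_zero]
    _ = _ := by
      refine Finset.sum_congr rfl fun a _ => ?_
      conv_lhs => rw [eq_scalar_smul (q j a ≫ f), Linear.comp_smul, Category.comp_id]

theorem sum_comp_scalar_smul {T : ι → C} [∀ i, Simple (T i)]
    (hT : ∀ i j, i ≠ j → ¬ Nonempty (T i ≅ T j)) {X : C} {n : ℕ}
    {p : ∀ i, Fin n → (X ⟶ T i)} {q : ∀ i, Fin n → (T i ⟶ X)}
    (h : ∑ i, ∑ a, p i a ≫ q i a = 𝟙 X) (j : ι) (f : T j ⟶ X) :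
    f = ∑ a, scalar (f ≫ p j a) • q j a := by
  calc f = f ≫ (∑ i, ∑ a, p i a ≫ q i a) := by rw [h, Category.comp_id]
    _ = ∑ i, ∑ a, (f ≫ p i a) ≫ q i a := by simp [Preadditive.comp_sum]
    _ = ∑ a, (f ≫ p j a) ≫ q j a := by
      refine Finset.sum_eq_single j (fun i _ hij => ?_) (by simp)
      refine Finset.sum_eq_zero fun a _ => ?_
      rw [eq_zero_of_not_iso (hT j i hij.symm) (f ≫ p i a), Limits.zero_comp]
    _ = _ := by
      refine Finset.sum_congr rfl fun a _ => ?_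
      conv_lhs => rw [eq_scalar_smul (f ≫ p j a), Linear.smul_comp, Category.id_comp]

variable [BraidedCategory C]

/-- The endomorphism of `X` given by a circle labelled `Y` around `X`. -/
def encircle (Y Y' : C) [ExactPairing Y Y'] (X : C) : X ⟶ X :=
  rightPartialTrace Y Y' (monodromy X Y)

theorem encircle_natural (Y Y' : C) [ExactPairing Y Y'] {X X' : C} (f : X ⟶ X') :
    f ≫ encircle Y Y' X' = encircle Y Y' X ≫ f := by
  have h1 := rightPartialTrace_natural Y Y' f (monodromy X' Y) (𝟙 X')
  have h2 := rightPartialTrace_natural Y Y' (𝟙 X) (monodromy X Y) f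
  simp only [id_whiskerRight, Category.comp_id, Category.id_comp, whiskerRight_monodromy] at h1 h2
  rw [encircle, encircle, ← h1, ← h2]

variable (S S' : ι → C) [∀ i, ExactPairing (S i) (S' i)]

/-- The endomorphism of `X` given by a circle around `X` that is labelled by the sum of the `S i`
weighted by their dimensions. -/
noncomputable def kirby (X : C) : X ⟶ X := ∑ i, qdim (S i) (S' i) • encircle (S i) (S' i) X

theorem kirby_natural {X X' : C} (f : X ⟶ X') : f ≫ kirby S S' X' = kirby S S' X ≫ f := by
  simp [kirby, Preadditive.comp_sum, Preadditive.sum_comp, encircle_natural]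

variable [∀ i, IsBalanced (S i) (S' i)] [∀ i, Simple (S i)] [∀ i, Simple (S' i)]

/-- A strand labelled by a simple object slides over the weighted circle. -/
theorem kirby_handle_slide (hS : ∀ i j, i ≠ j → ¬ Nonempty (S i ≅ S j))
    (hS' : ∀ i j, i ≠ j → ¬ Nonempty (S' i ≅ S' j))
    (Z Z' : C) [ExactPairing Z Z'] [IsBalanced Z Z'] [Simple Z]
    (hZ : ∀ i, FactorsThrough S (Z ⊗ S i)) (hZ' : ∀ k, FactorsThrough S' (S' k ⊗ Z)) (X : C) :
    (β_ X Z).hom ≫ Z ◁ kirby S S' X ≫ (β_ Z X).hom = kirby S S' X ▷ Z := by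
  choose n p q hpq using hZ
  choose m s t hst using hZ'
  let d (i : ι) : ℂ := qdim (S i) (S' i)
  let dZ : ℂ := qdim Z Z'
  let M (k : ι) := monodromy X (S k)
  let u (i k : ι) (a : Fin (n i)) : Z ⟶ S k ⊗ S' i := bendRight (S i) (S' i) (p i k a)
  let w (i k : ι) (a : Fin (n i)) : S k ⊗ S' i ⟶ Z := cobendRight (S i) (S' i) (q i k a)
  let u' (i k : ι) (c : Fin (m k)) : Z ⟶ S k ⊗ S' i := bendLeft (S k) (S' k) (s k i c)
  let w' (i k : ι) (c : Fin (m k)) : S k ⊗ S' i ⟶ Z := cobendLeft (S k) (S' k) (t k i c)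
  have hd (i) : d i ≠ 0 := qdim_ne_zero _ _
  -- Resolving `Z ⊗ S i` and `S' k ⊗ Z` and bending gives two spanning families of `Z ⟶ S k ⊗ S' i`,
  -- with cobent companions in the other direction. The weights `d i` and `d k` come from their
  -- different normalizations.
  have expand_left (i k : ι) (x : Z ⟶ S k ⊗ S' i) :
      d i • x = ∑ c, (dZ * scalar (x ≫ w' i k c)) • u' i k c := by
    obtain ⟨f, rfl⟩ := bendLeft_surjective (S k) (S' k) x
    conv_lhs => rw [sum_scalar_smul_comp hS' (hst k) i f, bendLeft_sum, Finset.smul_sum]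
    refine Finset.sum_congr rfl fun c _ => ?_
    rw [bendLeft_smul, smul_smul]
    congr 1
    have h := scalar_comp_mul_qdim_left (S k) (S' k) Z Z' (S i) (S' i) f (t k i c)
    rw [mul_comm, h, mul_comm]
  have expand_right (i k : ι) (x : S k ⊗ S' i ⟶ Z) :
      d k • x = ∑ a, (dZ * scalar (u i k a ≫ x)) • w i k a := by
    obtain ⟨f, rfl⟩ := cobendRight_surjective (S i) (S' i) x
    conv_lhs => rw [sum_comp_scalar_smul hS (hpq i) k f, cobendRight_sum, Finset.smul_sum]
    refine Finset.sum_congr rfl fun c _ => ?_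
    rw [cobendRight_smul, smul_smul]
    congr 1
    have h := scalar_comp_mul_qdim_right (S i) (S' i) Z Z' (S k) (S' k) (p i k c) f
    rw [mul_comm, h, mul_comm]
  -- The crossings with `Z` merge with the circle into the double braiding of `X` with `Z ⊗ S i`,
  -- which is then resolved into the `S k`.
  have lhs (i : ι) : (β_ X Z).hom ≫ Z ◁ encircle (S i) (S' i) X ≫ (β_ Z X).hom =
      ∑ k, ∑ a, sandwich (M k) (u i k a) (w i k a) := by
    have hM : monodromy X (Z ⊗ S i) = ∑ k, ∑ a, X ◁ p i k a ≫ M k ≫ X ◁ q i k a := by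
      calc _ = X ◁ (∑ k, ∑ a, p i k a ≫ q i k a) ≫ monodromy X (Z ⊗ S i) := by
            rw [hpq, whiskerLeft_id, Category.id_comp]
        _ = _ := by
          simp [whiskerLeft_sum, Preadditive.sum_comp, whiskerLeft_monodromy, M]
    rw [encircle, whiskerLeft_rightPartialTrace, ← rightPartialTrace_natural,
      monodromy_tensor_right, hM]
    simp only [Preadditive.sum_comp, Preadditive.comp_sum, rightPartialTrace_sum]
    refine Finset.sum_congr rfl fun k _ => Finset.sum_congr rfl fun a _ => ?_
    exact rightPartialTrace_sandwich (S i) (S' i) (M k) (p i k a) (q i k a)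
  have rhs (k : ι) : encircle (S k) (S' k) X ▷ Z =
      ∑ i, ∑ c, sandwich (M k) (u' i k c) (w' i k c) := by
    simp only [u', w', sandwich_bendLeft]
    simp only [← Preadditive.comp_sum, ← Preadditive.sum_comp, ← whiskerLeft_sum, hst]
    rw [encircle, rightPartialTrace_whiskerRight]
    simp [M]
  -- Rewriting `u` in terms of `u'` on one side and `w'` in terms of `w` on the other yields the
  -- same double sum, with coefficients `dZ * scalar (u ≫ w')`.
  calc _ = ∑ i, d i • ((β_ X Z).hom ≫ Z ◁ encircle (S i) (S' i) X ≫ (β_ Z X).hom) := by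
        simp [kirby, whiskerLeft_sum, Preadditive.sum_comp, Preadditive.comp_sum, d]
    _ = ∑ i, ∑ k, ∑ a, ∑ c,
        (dZ * scalar (u i k a ≫ w' i k c)) • sandwich (M k) (u' i k c) (w i k a) := by
      refine Finset.sum_congr rfl fun i _ => ?_
      rw [lhs, Finset.smul_sum]
      refine Finset.sum_congr rfl fun k _ => ?_
      rw [Finset.smul_sum]
      refine Finset.sum_congr rfl fun a _ => ?_
      rw [← sandwich_smul_left, expand_left, sandwich_sum_left]
      simp only [sandwich_smul_left]
    _ = ∑ k, ∑ i, ∑ c, ∑ a,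
        (dZ * scalar (u i k a ≫ w' i k c)) • sandwich (M k) (u' i k c) (w i k a) := by
      rw [Finset.sum_comm]
      refine Finset.sum_congr rfl fun k _ => Finset.sum_congr rfl fun i _ => ?_
      rw [Finset.sum_comm]
    _ = ∑ k, d k • encircle (S k) (S' k) X ▷ Z := by
      refine Finset.sum_congr rfl fun k _ => ?_
      rw [rhs, Finset.smul_sum]
      refine Finset.sum_congr rfl fun i _ => ?_
      rw [Finset.smul_sum]
      refine Finset.sum_congr rfl fun c _ => ?_
      rw [← sandwich_smul_right, expand_right, sandwich_sum_right]
      simp only [sandwich_smul_right]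
    _ = _ := by simp [kirby, sum_whiskerRight, d]

theorem monodromy_eq_id_of_kirby_ne_zero (hS : ∀ i j, i ≠ j → ¬ Nonempty (S i ≅ S j))
    (hS' : ∀ i j, i ≠ j → ¬ Nonempty (S' i ≅ S' j))
    (Z Z' : C) [ExactPairing Z Z'] [IsBalanced Z Z'] [Simple Z]
    (hZ : ∀ i, FactorsThrough S (Z ⊗ S i)) (hZ' : ∀ k, FactorsThrough S' (S' k ⊗ Z))
    (X : C) [Simple X] (hX : kirby S S' X ≠ 0) : monodromy X Z = 𝟙 (X ⊗ Z) := by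
  have h := kirby_handle_slide S S' hS hS' Z Z' hZ hZ' X
  have hc : scalar (kirby S S' X) ≠ 0 := by
    intro h0
    rw [eq_scalar_smul (kirby S S' X), h0, zero_smul] at hX
    exact hX rfl
  rw [eq_scalar_smul (kirby S S' X)] at h
  simp only [MonoidalLinear.whiskerLeft_smul, MonoidalLinear.smul_whiskerRight, whiskerLeft_id,
    id_whiskerRight, Linear.smul_comp, Linear.comp_smul, Category.id_comp] at h
  exact smul_right_injective _ hc h

end HandleSlide

/-! ### Sliding strands past caps and cups; the reversed braiding -/

section Braiding

variable {C : Type u} [Category.{v} C] [MonoidalCategory C] [BraidedCategory C]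

/-- By naturality `J` may pass the cup on either side; crossing the other leg requires the inverse
braiding. This is where the reversed braiding enters. -/
theorem whiskerLeft_cup_braiding {Y Y' : C} (a : 𝟙_ C ⟶ Y ⊗ Y') (J : C) :
    (ρ_ J).inv ≫ J ◁ a ≫ (α_ J Y Y').inv ≫ (β_ J Y).hom ▷ Y' ≫ (α_ Y J Y').hom =
      (λ_ J).inv ≫ a ▷ J ≫ (α_ Y Y' J).hom ≫ Y ◁ (β_ J Y').inv := by
  rw [← cancel_mono (Y ◁ (β_ J Y').hom ≫ (α_ Y Y' J).inv)]
  have h := BraidedCategory.braiding_naturality_right J a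
  simp only [BraidedCategory.braiding_tensor_right_hom, braiding_tensorUnit_right] at h
  have h' := congrArg (fun x => (ρ_ J).inv ≫ x) h
  simpa using h'

theorem braiding_whiskerLeft_cap {Y Y' : C} (b : Y ⊗ Y' ⟶ 𝟙_ C) (J : C) :
    (α_ Y J Y').inv ≫ (β_ Y J).hom ▷ Y' ≫ (α_ J Y Y').hom ≫ J ◁ b ≫ (ρ_ J).hom =
      Y ◁ (β_ Y' J).inv ≫ (α_ Y Y' J).inv ≫ b ▷ J ≫ (λ_ J).hom := by
  rw [← cancel_epi ((α_ Y Y' J).hom ≫ Y ◁ (β_ Y' J).hom)]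
  have h := BraidedCategory.braiding_naturality_left b J
  simp only [BraidedCategory.braiding_tensor_left_hom, braiding_tensorUnit_left] at h
  have h' := congrArg (fun x => x ≫ (ρ_ J).hom) h
  simpa using h'.symm

theorem monodromy_eq_id_of_iso_unit_right (X : C) {Y : C} (e : Y ≅ 𝟙_ C) :
    monodromy X Y = 𝟙 (X ⊗ Y) := by
  rw [← cancel_mono (X ◁ e.hom), ← whiskerLeft_monodromy]
  simp [monodromy]

theorem monodromy_eq_id_of_iso_unit_left {X : C} (e : X ≅ 𝟙_ C) (Y : C) :
    monodromy X Y = 𝟙 (X ⊗ Y) := by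
  rw [← cancel_mono (e.hom ▷ Y), ← whiskerRight_monodromy]
  simp [monodromy]

theorem monodromy_reverseBraiding (X Y : C) :
    @monodromy C _ _ (reverseBraiding C) X Y = (β_ Y X).inv ≫ (β_ X Y).inv := rfl

theorem monodromy_eq_id_of_reverseBraiding {X Y : C}
    (h : @monodromy C _ _ (reverseBraiding C) X Y = 𝟙 (X ⊗ Y)) : monodromy X Y = 𝟙 (X ⊗ Y) := by
  rw [monodromy_reverseBraiding] at h
  calc monodromy X Y = monodromy X Y ≫ (β_ Y X).inv ≫ (β_ X Y).inv := by rw [h, Category.comp_id]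
    _ = _ := by simp [monodromy]

end Braiding

/-! ### Centralizing can be tested on simple summands -/

section Centralize

variable {C : Type u} [Category.{v} C] [Preadditive C] [MonoidalCategory C]
  [MonoidalPreadditive C] [BraidedCategory C]

theorem centralizes_of_monodromy_eq_id {ι : Type*} [Fintype ι]
    {T : ι → C} {X Y : C} (hY : FactorsThrough T Y) (h : ∀ i, monodromy X (T i) = 𝟙 (X ⊗ T i)) :
    Centralizes X Y := by
  obtain ⟨n, p, q, hpq⟩ := hY
  change monodromy X Y = _
  calc monodromy X Y = X ◁ (∑ k, ∑ a, p k a ≫ q k a) ≫ monodromy X Y := by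
        rw [hpq, whiskerLeft_id, Category.id_comp]
    _ = X ◁ (∑ k, ∑ a, p k a ≫ q k a) := by
      simp [whiskerLeft_sum, Preadditive.sum_comp, whiskerLeft_monodromy, h]
    _ = _ := by rw [hpq, whiskerLeft_id]

end Centralize

/-! ### Pulling a linked circle off a strand -/

section Killing

variable {C : Type u} [Category.{v} C] [Preadditive C] [Linear ℂ C]
  [MonoidalCategory C] [MonoidalPreadditive C] [MonoidalLinear ℂ C] [RigidCategory C]
  [UnitaryTensorCategory C] [BraidedCategory C]

/-- The endomorphism of `X` given by a circle labelled `Y` around `X` that carries an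
endomorphism of the dual of `Y`. -/
def encircleWith (Y Y' : C) [ExactPairing Y Y'] (X : C) (e : Y' ⟶ Y') : X ⟶ X :=
  (ρ_ X).inv ≫ X ◁ (η_ Y Y' ≫ Y ◁ e) ≫ (α_ X Y Y').inv ≫ monodromy X Y ▷ Y' ≫
    (α_ X Y Y').hom ≫ X ◁ dag (η_ Y Y') ≫ (ρ_ X).hom

theorem encircleWith_smul (Y Y' : C) [ExactPairing Y Y'] (X : C) (c : ℂ) (e : Y' ⟶ Y') :
    encircleWith Y Y' X (c • e) = c • encircleWith Y Y' X e := by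
  simp [encircleWith]

theorem encircleWith_sum (Y Y' : C) [ExactPairing Y Y'] (X : C) {J : Type*} (A : Finset J)
    (e : J → (Y' ⟶ Y')) :
    encircleWith Y Y' X (∑ j ∈ A, e j) = ∑ j ∈ A, encircleWith Y Y' X (e j) := by
  simp [encircleWith, Preadditive.comp_sum, Preadditive.sum_comp, whiskerLeft_sum]

theorem encircleWith_zero (Y Y' : C) [ExactPairing Y Y'] (X : C) :
    encircleWith Y Y' X 0 = 0 := by
  simp [encircleWith]

/-- A circle labelled `J` that is linked to a circle around `X` can be pulled off `X`. -/
theorem rightPartialTrace_encircle (Y Y' J J' : C) [ExactPairing Y Y'] [ExactPairing J J'] (X : C) :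
    rightPartialTrace J J' (encircle Y Y' (X ⊗ J)) =
      encircleWith Y Y' X (@encircle C _ _ _ _ _ _ _ _ (reverseBraiding C) J J' _ Y') := by
  have hr : @encircle C _ _ _ _ _ _ _ _ (reverseBraiding C) J J' _ Y' =
      rightPartialTrace J J' ((β_ J Y').inv ≫ (β_ Y' J).inv) := rfl
  rw [hr]
  simp only [rightPartialTrace, encircle, encircleWith, monodromy_tensor_left]
  calc
    _ = 𝟙 _ ⊗≫ X ◁ (η_ J J' ≫ ((ρ_ J).inv ≫ J ◁ η_ Y Y' ≫ (α_ J Y Y').inv ≫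
          (β_ J Y).hom ▷ Y' ≫ (α_ Y J Y').hom) ▷ J') ⊗≫ monodromy X Y ▷ ((J ⊗ Y') ⊗ J') ⊗≫
        X ◁ (((α_ Y J Y').inv ≫ (β_ Y J).hom ▷ Y' ≫ (α_ J Y Y').hom ≫ J ◁ dag (η_ Y Y') ≫
          (ρ_ J).hom) ▷ J' ≫ dag (η_ J J')) ⊗≫ 𝟙 _ := by monoidal
    _ = 𝟙 _ ⊗≫ X ◁ (𝟙_ C ◁ η_ J J' ≫ η_ Y Y' ▷ (J ⊗ J')) ⊗≫ X ◁ Y ◁ (β_ J Y').inv ▷ J' ⊗≫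
        monodromy X Y ▷ ((J ⊗ Y') ⊗ J') ⊗≫ X ◁ Y ◁ (β_ Y' J).inv ▷ J' ⊗≫
        X ◁ (dag (η_ Y Y') ▷ (J ⊗ J') ≫ 𝟙_ C ◁ dag (η_ J J')) ⊗≫ 𝟙 _ := by
      -- The strand `J` moves from the leg `Y` of the circle to the leg `Y'`, away from `X`.
      rw [whiskerLeft_cup_braiding, braiding_whiskerLeft_cap]
      monoidal
    _ = 𝟙 _ ⊗≫ X ◁ (η_ Y Y' ▷ 𝟙_ C ≫ (Y ⊗ Y') ◁ η_ J J') ⊗≫ X ◁ Y ◁ (β_ J Y').inv ▷ J' ⊗≫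
        monodromy X Y ▷ ((J ⊗ Y') ⊗ J') ⊗≫ X ◁ Y ◁ (β_ Y' J).inv ▷ J' ⊗≫
        X ◁ ((Y ⊗ Y') ◁ dag (η_ J J') ≫ dag (η_ Y Y') ▷ 𝟙_ C) ⊗≫ 𝟙 _ := by
      rw [whisker_exchange, whisker_exchange]
    _ = 𝟙 _ ⊗≫ X ◁ η_ Y Y' ⊗≫ X ◁ Y ◁ (Y' ◁ η_ J J' ⊗≫ (β_ J Y').inv ▷ J') ⊗≫
        (monodromy X Y ▷ ((J ⊗ Y') ⊗ J') ≫
          (X ⊗ Y) ◁ ((β_ Y' J).inv ▷ J' ≫ (α_ Y' J J').hom ≫ Y' ◁ dag (η_ J J') ≫ (ρ_ Y').hom)) ⊗≫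
        X ◁ dag (η_ Y Y') ⊗≫ 𝟙 _ := by monoidal
    _ = _ := by
      rw [← whisker_exchange]
      monoidal

variable {ι : Type*} [Fintype ι] (S S' : ι → C) [∀ i, ExactPairing (S i) (S' i)]

/-- Both circles carry the same weights, so the roles of the two summation indices can be exchanged.
-/
theorem sum_rightPartialTrace_kirby (X : C) :
    ∑ j, qdim (S j) (S' j) • rightPartialTrace (S j) (S' j) (kirby S S' (X ⊗ S j)) =
      ∑ i, qdim (S i) (S' i) • encircleWith (S i) (S' i) X
        (@kirby C _ _ _ _ _ _ _ _ _ _ (reverseBraiding C) S S' _ (S' i)) := by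
  simp only [kirby, rightPartialTrace_sum, rightPartialTrace_smul, rightPartialTrace_encircle,
    encircleWith_sum, encircleWith_smul, Finset.smul_sum]
  rw [Finset.sum_comm]
  refine Finset.sum_congr rfl fun i _ => Finset.sum_congr rfl fun j _ => ?_
  rw [smul_smul, smul_smul, mul_comm]

/-- If the weighted circle with the reversed crossings kills all `S' i` that are not trivial, then
the weighted circle around some `X ⊗ S j` is nonzero. -/
theorem exists_kirby_ne_zero [∀ i, Simple (S i)] (i₀ : ι) (e : S i₀ ≅ 𝟙_ C) (e' : S' i₀ ≅ 𝟙_ C)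
    (h : ∀ i, i ≠ i₀ → @kirby C _ _ _ _ _ _ _ _ _ _ (reverseBraiding C) S S' _ (S' i) = 0)
    (X : C) [Simple X] : ∃ j, kirby S S' (X ⊗ S j) ≠ 0 := by
  by_contra! h0
  have h1 := sum_rightPartialTrace_kirby S S' X
  have h2 : @kirby C _ _ _ _ _ _ _ _ _ _ (reverseBraiding C) S S' _ (S' i₀) =
      (∑ j, qdim (S j) (S' j) * qdim (S j) (S' j)) • 𝟙 (S' i₀) := by
    let := reverseBraiding C
    simp only [kirby, encircle, monodromy_eq_id_of_iso_unit_left e', rightPartialTrace_id,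
      smul_smul, Finset.sum_smul]
  have h3 : encircleWith (S i₀) (S' i₀) X (𝟙 (S' i₀)) = qdim (S i₀) (S' i₀) • 𝟙 X := by
    rw [← rightPartialTrace_id, ← monodromy_eq_id_of_iso_unit_right X e]
    simp [encircleWith, rightPartialTrace]
  have hl : ∑ j, qdim (S j) (S' j) • rightPartialTrace (S j) (S' j) (kirby S S' (X ⊗ S j)) = 0 := by
    refine Finset.sum_eq_zero fun j _ => ?_
    rw [h0 j]
    simp [rightPartialTrace]
  -- Only the unit label survives. Its term is the squared dimension of `S i₀` times the sum of all
  -- squared dimensions, which is nonzero because dimensions are positive reals.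
  rw [hl, Finset.sum_eq_single i₀ (fun i _ hi => by rw [h i hi, encircleWith_zero, smul_zero])
    (by simp), h2, encircleWith_smul, h3, smul_smul, smul_smul] at h1
  choose r hr hrd using fun i => exists_qdim_eq (S i) (S' i)
  have hpos : 0 < ∑ j, r j * r j :=
    Finset.sum_pos (fun j _ => mul_pos (hr j) (hr j)) ⟨i₀, Finset.mem_univ _⟩
  have hsum : (∑ j, qdim (S j) (S' j) * qdim (S j) (S' j)) = ((∑ j, r j * r j : ℝ) : ℂ) := by
    simp [hrd]
  rw [hsum, eq_comm] at h1
  have hd := qdim_ne_zero (S i₀) (S' i₀)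
  have hne : ((∑ j, r j * r j : ℝ) : ℂ) ≠ 0 := by exact_mod_cast hpos.ne'
  exact (smul_ne_zero (mul_ne_zero (mul_ne_zero hd hne) hd) (id_nonzero X)) h1

end Killing

/-! ### Simple objects of a fusion subcategory -/

section Family

variable {C : Type u} [Category.{v} C] [Preadditive C] [Linear ℂ C]
  [MonoidalCategory C] [MonoidalPreadditive C] [MonoidalLinear ℂ C] [RigidCategory C]
  [UnitaryTensorCategory C]

/-- A fusion subcategory has a finite set of representatives of its simple objects. -/
theorem exists_simple_representatives (D : ObjectProperty C) [IsFusionSubcategory D] :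
    ∃ (n : ℕ) (S : Fin n → C), (∀ i, D (S i)) ∧ (∀ i, Simple (S i)) ∧
      (∀ i j, i ≠ j → ¬ Nonempty (S i ≅ S j)) ∧
      ∀ X, D X → Simple X → ∃ i, Nonempty (X ≅ S i) := by
  obtain ⟨n, T, hT⟩ := IsFusionSubcategory.finite_simple (D := D)
  let P : Set (Fin n) := {m | D (T m) ∧ Simple (T m)}
  let r : Setoid P :=
    { r := fun a b => Nonempty (T a ≅ T b)
      iseqv := ⟨fun _ => ⟨Iso.refl _⟩, fun ⟨e⟩ => ⟨e.symm⟩, fun ⟨e⟩ ⟨e'⟩ => ⟨e ≪≫ e'⟩⟩ }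
  have : Finite (Quotient r) := inferInstance
  obtain ⟨k, ⟨φ⟩⟩ := Finite.exists_equiv_fin (Quotient r)
  refine ⟨k, fun i => T (φ.symm i).out, fun i => (φ.symm i).out.2.1, fun i => (φ.symm i).out.2.2,
    fun i j hij h => hij ?_, fun X hX hs => ?_⟩
  · have := Quotient.sound (s := r) h
    rw [Quotient.out_eq, Quotient.out_eq] at this
    exact φ.symm.injective this
  · obtain ⟨m, ⟨e⟩⟩ := hT X hX hs
    have hm : m ∈ P := ⟨D.prop_of_iso e hX, Simple.of_iso e.symm⟩
    refine ⟨φ (Quotient.mk r ⟨m, hm⟩), ?_⟩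
    obtain ⟨e'⟩ := Quotient.exact (s := r)
      (Quotient.out_eq (φ.symm (φ (Quotient.mk r ⟨m, hm⟩))) |>.trans (φ.symm_apply_apply _))
    exact ⟨e ≪≫ e'.symm⟩

theorem factorsThrough_of_mem {D : ObjectProperty C} [IsFusionSubcategory D] {ι : Type*} [Fintype ι]
    {T : ι → C} (hT : ∀ X, D X → Simple X → ∃ i, Nonempty (X ≅ T i)) {X : C} (hX : D X) :
    FactorsThrough T X := by
  classical
  obtain ⟨n, A, s, hA, hs⟩ := UnitaryTensorCategory.semisimple X
  have hD (a : Fin n) : D (A a) := D.prop_of_retract ⟨s a, dag (s a), hs.isometry a⟩ hX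
  choose l hl using fun a => hT (A a) (hD a) (hA a)
  let e (a : Fin n) : A a ≅ T (l a) := (hl a).some
  -- The summand `a` contributes only at its own label `l a`; at every other label both morphisms
  -- are zero.
  refine ⟨n, fun i a => if h : l a = i then dag (s a) ≫ (e a).hom ≫ eqToHom (by rw [h]) else 0,
    fun i a => if h : l a = i then eqToHom (by rw [h]) ≫ (e a).inv ≫ s a else 0, ?_⟩
  rw [Finset.sum_comm, ← hs.sum_eq]
  refine Finset.sum_congr rfl fun a _ => ?_
  rw [Finset.sum_eq_single (l a) (fun i _ hi => by simp [hi.symm]) (by simp)]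
  simp

theorem exists_simple_not_mem (D : ObjectProperty C) [IsFusionSubcategory D]
    (h : ∃ X : C, ¬ D X) : ∃ X : C, Simple X ∧ ¬ D X := by
  obtain ⟨X, hX⟩ := h
  obtain ⟨n, A, s, hA, hs⟩ := UnitaryTensorCategory.semisimple X
  by_contra! hall
  exact hX (IsFusionSubcategory.sum_mem A X s hs fun i => hall _ (hA i))

theorem cobendRight_ne_zero (Y Y' : C) [ExactPairing Y Y'] {Z K : C} {q : K ⟶ Z ⊗ Y} (hq : q ≠ 0) :
    cobendRight Y Y' q ≠ 0 := by
  let := dagPairing Y Y'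
  intro h
  refine hq ((tensorRightHomEquiv K Y' Y Z).symm.injective ?_)
  have h0 : cobendRight Y Y' (0 : K ⟶ Z ⊗ Y) = 0 := by simp [cobendRight]
  exact h.trans h0.symm

end Family

end UnitaryCat

/-! ### The centralizing simple object -/

open UnitaryCat in
theorem mainTheorem7 {C : Type u} [Category.{v} C] [Preadditive C] [Linear ℂ C]
    [MonoidalCategory C] [MonoidalPreadditive C] [MonoidalLinear ℂ C] [RigidCategory C]
    [UnitaryCat.UnitaryTensorCategory C] [BraidedCategory C]
    (D : ObjectProperty C) [UnitaryCat.IsFusionSubcategory D]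
    (hnondeg : UnitaryCat.IsNondegenerate D)
    (hproper : ∃ X : C, ¬ D X) :
    ∃ a : C, Simple a ∧ ¬ D a ∧ UnitaryCat.CentralizesSubcategory a D := by
  obtain ⟨X, hXs, hXD⟩ := exists_simple_not_mem D hproper
  obtain ⟨n, S, hSD, hSs, hS, hScov⟩ := exists_simple_representatives D
  let S' : Fin n → C := fun i => HasRightDual.rightDual (S i)
  have hS'D (i) : D (S' i) := IsFusionSubcategory.rightDual_mem _ (hSD i)
  have hbal (i) : ∃ e : ExactPairing (S i) (S' i), @IsBalanced C _ _ _ _ _ _ _ (S i) (S' i) e :=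
    exists_balanced_pairing (S i) (S' i)
  choose pair hpair using hbal
  have hS's (i) : Simple (S' i) := simple_of_exactPairing (S i) (S' i)
  have hdual (i j) (e : S' i ≅ S' j) : Nonempty (S i ≅ S j) :=
    ⟨leftDualIso (pair i) (let := pair j; exactPairingCongrRight e)⟩
  have hS' (i j) (hij : i ≠ j) : ¬ Nonempty (S' i ≅ S' j) := fun ⟨e⟩ => hS i j hij (hdual i j e)
  -- `Y` is a right dual of its left dual `L`, and `L` is isomorphic to some `S i`. Thus the duals
  -- form a second set of representatives, with no need to match it with `S`.
  have hS'cov (Y : C) (hY : D Y) (hYs : Simple Y) : ∃ i, Nonempty (Y ≅ S' i) := by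
    let L : C := HasLeftDual.leftDual Y
    have hLs : Simple L :=
      let := dagPairing L Y
      simple_of_exactPairing Y L
    obtain ⟨i, ⟨e⟩⟩ := hScov L (IsFusionSubcategory.leftDual_mem _ hY) hLs
    exact ⟨i, ⟨rightDualIso (inferInstance : ExactPairing L Y)
      (let := pair i; exactPairingCongrLeft e)⟩⟩
  have hf (k i) : FactorsThrough S (S k ⊗ S i) :=
    factorsThrough_of_mem hScov (ObjectProperty.prop_tensor (hSD k) (hSD i))
  have hf' (k i) : FactorsThrough S' (S' i ⊗ S k) :=
    factorsThrough_of_mem hS'cov (ObjectProperty.prop_tensor (hS'D i) (hSD k))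
  obtain ⟨i₀, ⟨e₀⟩⟩ := hScov (𝟙_ C) D.prop_unit inferInstance
  have e₀' : S' i₀ ≅ 𝟙_ C := by
    let := pair i₀
    exact rightDualIso (exactPairingCongrLeft e₀) (inferInstance : ExactPairing (𝟙_ C) (𝟙_ C))
  -- A nonzero reversed circle would make `S' i` centralize `D`, because double braidings for the
  -- two braidings are trivial together.
  have hkill (i) (hi : i ≠ i₀) :
      @kirby C _ _ _ _ _ _ _ _ _ _ (reverseBraiding C) S S' _ (S' i) = 0 := by
    by_contra hne
    obtain ⟨e⟩ := hnondeg (S' i) (hS'D i) (hS's i) fun Y hY =>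
      centralizes_of_monodromy_eq_id (factorsThrough_of_mem hScov hY) fun k =>
        monodromy_eq_id_of_reverseBraiding (by
          let := reverseBraiding C
          exact monodromy_eq_id_of_kirby_ne_zero S S' hS hS' (S k) (S' k) (hf k) (hf' k) _ hne)
    exact hS' i i₀ hi ⟨e ≪≫ e₀'.symm⟩
  obtain ⟨j, hj⟩ := exists_kirby_ne_zero S S' i₀ e₀.symm e₀' hkill X
  obtain ⟨m, A, s, hA, hs⟩ := UnitaryTensorCategory.semisimple (X ⊗ S j)
  -- By naturality the circle acts on each summand separately, so it is nonzero on one of them.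
  obtain ⟨a, ha⟩ : ∃ a, kirby S S' (A a) ≠ 0 := by
    by_contra! h0
    apply hj
    calc kirby S S' (X ⊗ S j) = (∑ a, DaggerCategory.dag (s a) ≫ s a) ≫ kirby S S' (X ⊗ S j) := by
          rw [hs.sum_eq, Category.id_comp]
      _ = 0 := by
        rw [Preadditive.sum_comp]
        refine Finset.sum_eq_zero fun a _ => ?_
        rw [Category.assoc, kirby_natural, h0, Limits.zero_comp, Limits.comp_zero]
  have := hA a
  refine ⟨A a, hA a, fun hD => hXD ?_, fun Y hY =>
    centralizes_of_monodromy_eq_id (factorsThrough_of_mem hScov hY) fun k =>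
      monodromy_eq_id_of_kirby_ne_zero S S' hS hS' (S k) (S' k) (hf k) (hf' k) _ ha⟩
  have hsa : s a ≠ 0 := by
    intro h0
    apply id_nonzero (A a)
    rw [← hs.isometry, h0, Limits.zero_comp]
  -- Bending the inclusion of `A a` into `X ⊗ S j` gives a nonzero map from `A a ⊗ S' j` to the
  -- simple object `X`.
  obtain ⟨r⟩ := exists_retract_of_ne_zero (cobendRight_ne_zero (S j) (S' j) hsa)
  exact D.prop_of_retract r (ObjectProperty.prop_tensor hD (hS'D j))
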